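/- **Setting.** Let $K=\mathrm{conv}\{Q_1,\dots,Q_4\}\subset\mathbb R^3$ be a tetrahedron of positive volume, let $F_m$ be its face opposite to $Q_m$, let $c_K\in\mathrm{int}(K)$, and let $c_m\in\mathrm{relint}(F_m)$ for $m=1,\dots,4$. The Worsey–Farin partition $\widehat{\mathcal T}=WF3D(K)$ consists of the $12$ tetrahedra $\mathrm{conv}\{Q_j,Q_k,c_K,c_m\}$ with $1\le j<k\le 4$ and $m\in\{1,2,3,4\}\setminus\{j,k\}$. Let $P_3(\widehat{\mathcal T})$ be the space of functions on $K$ that are polynomials of total degree at most $3$ on each $T\in\widehat{\mathcal T}$. For $1\le j<k\le 4$ let $Q_{jk}=(Q_j+Q_k)/2$ and fix unit vectors $\nu_{jk,1},\nu_{jk,2}$ which together with $Q_k-Q_j$ span $\mathbb R^3$ (for example an orthonormal basis of the plane normal to the edge). For $f\in C^1(K)$ define the $28$ degrees of freedom $$L_\mu(f)=f(Q_\mu),\qquad L_{4\ell+\mu}(f)=\nabla f(Q_\mu)\cdot e_\ell\qquad(\mu=1,\dots,4,\ \ell=1,2,3),$$ $$L_{20-2^{4-j}+2k+m}(f)=\nabla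 f(Q_{jk})\cdot\nu_{jk,m}\qquad(1\le j<k\le 4,\ m=1,2).$$ **Algorithm WF-CT3D.** The input is $x\in\mathbb R^{28}$ and an enumeration $(P_1,\dots,P_4)$ of the vertices of each $T\in\widehat{\mathcal T}$ with $P_1=c_K$, $P_2=c_m$ and $\{P_3,P_4\}=\{Q_j,Q_k\}$. The output is a family of ordinates $c_T(\alpha)$ ($T\in\widehat{\mathcal T}$, $\alpha\in\mathbb N_0^4$, $|\alpha|=3$) and the function $f$ on $K$ with $f=6\sum_{|\alpha|=3}c_T(\alpha)\lambda^\alpha/\alpha!$ at $\sum_\mu\lambda_\mu P_\mu\in T$ for each $T$, where $\lambda_\mu\ge0$ and $\sum_\mu\lambda_\mu=1$. They are computed as follows. (a) Set $f(Q_\mu)=x_\mu$ and $\nabla f(Q_\mu)=(x_{4+\mu},x_{8+\mu},x_{12+\mu})$. On each edge $\mathrm{conv}\{Q_j,Q_k\}$, the one-dimensional cubic Hermite interpolation of the values and tangential derivatives at $Q_j$ and $Q_k$ provides $f(Q_{jk})$ and $\nabla f(Q_{jk})\cdot(Q_k-Q_j)$. Together with $\nabla f(Q_{jk})\cdot\nu_{jk,m}=x_{20-2^{4-j}+2k+m}$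 for $m=1,2$ this determines $\nabla f(Q_{jk})$. (b) Let $g$ be the polynomial of total degree at most $2$ with $g(Q_\ell)=f(Q_\ell)-\frac13(Q_\ell-c_K)\cdot\nabla f(Q_\ell)$ for all $\ell$ and $g(Q_{jk})=\frac13(c_K-Q_{jk})\cdot\nabla f(Q_{jk})+f(Q_{jk})$ for all $j<k$. The ordinates $c_T(\alpha)$ with $\alpha_1\ge1$ are those in $g|_T=2\sum_{|\beta|=2}c_T(e_1+\beta)\lambda^\beta/\beta!$. (c) For each $m$ let $f_m$ be the two-dimensional Hsieh–Clough–Tocher interpolation on $F_m$. That is, $f_m\in C^1(F_m)$ is cubic on each of the three triangles $\mathrm{conv}\{c_m,Q_j,Q_k\}$ with $m\notin\{j,k\}$, and it interpolates the values and tangential derivatives from (a) at the vertices of $F_m$ and, at the midpoint of each edge of $F_m$, the derivative from (a) in the direction parallel to $F_m$ and perpendicular to the edge. The ordinates $c_T(\alpha)$ with $\alpha_1=0$ are those in $f_m=6\sum_{|\alpha|=3,\ \alpha_1=0}c_T(\alpha)\lambda^\alpha/\alpha!$ on $T\cap F_m=\mathrm{conv}\{c_m,Q_j,Q_k\}$.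 **Theorem (WF finite element).** (a) For any input $x_1,\dots,x_{28}\in\mathbb R$, Algorithm WF-CT3D has a unique output $(c_T(\alpha))$, $f$. The function $f$ belongs to $C^1(K)\cap P_3(\widehat{\mathcal T})$ and satisfies $L_\mu f=x_\mu$ for $\mu=1,\dots,28$. (b) For any $x_1,\dots,x_{28}\in\mathbb R$ there is at most one $f\in C^1(K)\cap P_3(\widehat{\mathcal T})$ with $L_\mu f=x_\mu$ for $\mu=1,\dots,28$. (c) The triple $(K,\,C^1(K)\cap P_3(\widehat{\mathcal T}),\,(L_1,\dots,L_{28}))$ is a finite element in the sense of Ciarlet: $K$ is compact with nonempty interior and Lipschitz boundary, the function space is finite-dimensional, and $L_1,\dots,L_{28}$ are linearly independent linear forms on it such that for all $a\in\mathbb R^{28}$ exactly one $f$ in the space satisfies $L_\mu f=a_\mu$ for $\mu=1,\dots,28$. -/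

import Mathlib

open Set Topology

noncomputable section

namespace WorseyFarin

/-- Three-dimensional Euclidean space. -/
abbrev E3 : Type := EuclideanSpace ℝ (Fin 3)

/-! ### Finite elements in the sense of Ciarlet -/

/-- Near each of its boundary points, `K` is the set of points lying on or above the graph
(in the direction of a unit vector `u`, over the hyperplane orthogonal to `u`) of a Lipschitz
continuous function. The vector `y - ⟪u, y⟫ u` is the orthogonal projection of `y` onto that
hyperplane. -/
def HasLipschitzBoundary {n : ℕ} (K : Set (EuclideanSpace ℝ (Fin n))) : Prop :=
  ∀ x ∈ frontier K, ∃ (u : EuclideanSpace ℝ (Fin n)) (φ : EuclideanSpace ℝ (Fin n) → ℝ)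
    (C : NNReal), ‖u‖ = 1 ∧ LipschitzWith C φ ∧
      ∀ᶠ y in 𝓝 x, (y ∈ K ↔ φ (y - (inner ℝ u y : ℝ) • u) ≤ inner ℝ u y)

/-- `(K, P, (L_1, …, L_N))` is a finite element in the sense of Ciarlet: `K` is a compact set with
nonempty interior and Lipschitz boundary, `P` is a finite-dimensional space of real functions on
`K`, and the linear forms `L_1, …, L_N` on `P` are linearly independent and `P`-unisolvent. -/
structure IsCiarletFiniteElement {n N : ℕ} (K : Set (EuclideanSpace ℝ (Fin n)))
    (P : Submodule ℝ (K → ℝ)) (L : Fin N → Module.Dual ℝ P) : Prop where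
  isCompact : IsCompact K
  interior_nonempty : (interior K).Nonempty
  lipschitz_boundary : HasLipschitzBoundary K
  finiteDimensional : FiniteDimensional ℝ P
  linearIndependent : LinearIndependent ℝ L
  unisolvent : ∀ a : Fin N → ℝ, ∃! p : P, ∀ i, L i p = a i

/-! ### Function spaces on a subset of `ℝ³` -/

/-- Extension by zero of a function on `K`. -/
def ext {K : Set E3} (f : K → ℝ) : E3 → ℝ := Function.extend Subtype.val f 0

theorem ext_apply {K : Set E3} (f : K → ℝ) (x : K) : ext f x = f x :=
  Subtype.val_injective.extend_apply f 0 x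

theorem ext_add {K : Set E3} (f g : K → ℝ) : ext (f + g) = ext f + ext g := by
  unfold ext
  rw [← Function.extend_add, add_zero]

theorem ext_smul {K : Set E3} (a : ℝ) (f : K → ℝ) : ext (a • f) = a • ext f := by
  unfold ext
  rw [← Function.extend_smul, smul_zero]

theorem ext_zero {K : Set E3} : ext (0 : K → ℝ) = 0 := by
  simpa using ext_smul (0 : ℝ) (0 : K → ℝ)

/-- `C¹(K)`. The notion `ContDiffOn ℝ 1 _ K` only depends on the values in `K`. -/
def C1 (K : Set E3) : Submodule ℝ (K → ℝ) where
  carrier := {f | ContDiffOn ℝ 1 (ext f) K}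
  zero_mem' := by
    change ContDiffOn ℝ 1 (ext (0 : K → ℝ)) K
    rw [ext_zero]
    exact contDiffOn_const
  add_mem' := by
    intro f g hf hg
    change ContDiffOn ℝ 1 (ext (f + g)) K
    rw [ext_add]
    exact ContDiffOn.add hf hg
  smul_mem' := by
    intro a f hf
    change ContDiffOn ℝ 1 (ext (a • f)) K
    rw [ext_smul]
    exact ContDiffOn.const_smul a hf

/-- The value at `x` of a polynomial in the three Cartesian coordinates. -/
def polyVal (p : MvPolynomial (Fin 3) ℝ) (x : E3) : ℝ := MvPolynomial.eval (fun i => x i) p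

/-- `P_k(𝒯)`: the functions on `K` whose restriction to each `T ∈ 𝒯` is a polynomial of total degree
at most `k`. -/
def piecewisePoly (K : Set E3) (k : ℕ) (𝒯 : Set (Set E3)) : Submodule ℝ (K → ℝ) where
  carrier := {f | ∀ T ∈ 𝒯, ∃ p : MvPolynomial (Fin 3) ℝ, p.totalDegree ≤ k ∧
    ∀ x : K, (x : E3) ∈ T → f x = polyVal p x}
  zero_mem' := fun T _ => ⟨0, by simp, by simp [polyVal]⟩
  add_mem' := by
    intro f g hf hg T hT
    obtain ⟨p, hp, hfp⟩ := hf T hT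
    obtain ⟨q, hq, hgq⟩ := hg T hT
    refine ⟨p + q, (MvPolynomial.totalDegree_add p q).trans (max_le hp hq), fun x hx => ?_⟩
    simp only [Pi.add_apply, hfp x hx, hgq x hx, polyVal, map_add]
  smul_mem' := by
    intro a f hf T hT
    obtain ⟨p, hp, hfp⟩ := hf T hT
    refine ⟨a • p, (MvPolynomial.totalDegree_smul_le a p).trans hp, fun x hx => ?_⟩
    simp only [Pi.smul_apply, hfp x hx, polyVal, MvPolynomial.smul_eval, smul_eq_mul]

/-! ### Bernstein polynomials -/

/-- `A_k`: the multi-indices `α ∈ ℕ₀^m` of length `|α| = k`. -/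
abbrev MultiIndex (m k : ℕ) : Type :=
  {α : Fin m → ℕ // α ∈ Finset.piAntidiag (Finset.univ : Finset (Fin m)) k}

/-- The multi-index `e_i + β`. -/
def MultiIndex.addUnit {m k : ℕ} (i : Fin m) (β : MultiIndex m k) : MultiIndex m (k + 1) :=
  ⟨Pi.single i 1 + β.1, by
    have h := (Finset.mem_piAntidiag.1 β.2).1
    simp [Finset.mem_piAntidiag, Finset.sum_add_distrib, h, add_comm]⟩

/-- `k! ∑_{|α| = k} c(α) w^α / α!`, the polynomial with ordinates `c` at barycentric coordinates
`w`. -/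
def bernstein {m k : ℕ} (c : MultiIndex m k → ℝ) (w : Fin m → ℝ) : ℝ :=
  (k.factorial : ℝ) * ∑ α : MultiIndex m k, c α * ∏ i, w i ^ α.1 i / ((α.1 i).factorial : ℝ)

/-! ### The Worsey-Farin partition

The indices `1, 2, 3, 4` of the vertices are `0, 1, 2, 3 : Fin 4` here. -/

/-- A tetrahedron `K = conv {Q_1, …, Q_4}` of positive volume with a centre `c_K` in its interior and,
for each `m`, a centre `c_m` in the relative interior of the face opposite to `Q_m`. -/
structure Partition where
  Q : Fin 4 → E3
  affineIndependent : AffineIndependent ℝ Q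
  cK : E3
  c : Fin 4 → E3
  cK_mem : cK ∈ interior (convexHull ℝ (range Q))
  c_mem : ∀ m, ∃ w : Fin 4 → ℝ, ∑ j, w j = 1 ∧ w m = 0 ∧ (∀ j, j ≠ m → 0 < w j) ∧
    c m = ∑ j, w j • Q j

/-- The edges of the tetrahedron: pairs `(j, k)` with `j < k`. -/
abbrev Edge : Type := {e : Fin 4 × Fin 4 // e.1 < e.2}

/-- The twelve pairs of an edge `(j, k)` and an index `m ∉ {j, k}`. -/
abbrev SubTet : Type := {t : Edge × Fin 4 // t.2 ≠ t.1.1.1 ∧ t.2 ≠ t.1.1.2}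

namespace Partition

variable (W : Partition)

/-- The tetrahedron `K`. -/
def K : Set E3 := convexHull ℝ (range W.Q)

/-- The subtetrahedron `conv {Q_j, Q_k, c_K, c_m}`. -/
def subTet (t : SubTet) : Set E3 :=
  convexHull ℝ {W.Q t.1.1.1.1, W.Q t.1.1.1.2, W.cK, W.c t.1.2}

/-- The Worsey-Farin partition of `K`. -/
def WF3D : Set (Set E3) := range W.subTet

/-- The face `F_m` of `K` opposite to the vertex `Q_m`. -/
def face (m : Fin 4) : Set E3 := convexHull ℝ (W.Q '' {j | j ≠ m})

/-- The linear span of the differences of points of `F_m`: the vectors parallel to `F_m`. -/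
def faceDirection (m : Fin 4) : Submodule ℝ E3 := vectorSpan ℝ (W.Q '' {j | j ≠ m})

/-- The vector `Q_k - Q_j` along the edge `(j, k)`. -/
def edgeVec (e : Edge) : E3 := W.Q e.1.2 - W.Q e.1.1

/-- The midpoint `Q_jk` of the edge `(j, k)`. -/
def mid (e : Edge) : E3 := (1 / 2 : ℝ) • (W.Q e.1.1 + W.Q e.1.2)

/-- The space `C¹(K) ∩ P_3(WF3D(K))`. -/
def space : Submodule ℝ (W.K → ℝ) := C1 W.K ⊓ piecewisePoly W.K 3 W.WF3D

theorem uniqueDiffOn : UniqueDiffOn ℝ W.K :=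
  uniqueDiffOn_convex (convex_convexHull ℝ _) ⟨W.cK, W.cK_mem⟩

theorem Q_mem (j : Fin 4) : W.Q j ∈ W.K := subset_convexHull ℝ _ (mem_range_self j)

theorem mid_mem (e : Edge) : W.mid e ∈ W.K := by
  have h := (convex_convexHull ℝ (range W.Q)) (W.Q_mem e.1.1) (W.Q_mem e.1.2)
    (a := (1 / 2 : ℝ)) (b := (1 / 2 : ℝ)) (by norm_num) (by norm_num) (by norm_num)
  rw [mid, smul_add]
  exact h

/-- Unit vectors `ν_jk,1` and `ν_jk,2` for each edge which, together with a tangent vector of the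
edge, span `ℝ³`; for example an orthonormal basis of the plane normal to the edge. -/
structure EdgeNormals where
  vec : Edge → Fin 2 → E3
  norm_eq_one : ∀ e i, ‖vec e i‖ = 1
  span_eq_top : ∀ e, Submodule.span ℝ {W.edgeVec e, vec e 0, vec e 1} = ⊤

/-! ### The degrees of freedom -/

/-- Point evaluation `f ↦ f(x)` on `C¹(K)`. -/
def evalForm (x : W.K) : Module.Dual ℝ (C1 W.K) where
  toFun f := f.1 x
  map_add' _ _ := rfl
  map_smul' _ _ := rfl

/-- The directional derivative `f ↦ ∇f(x) · v` on `C¹(K)`, for `x ∈ K`. -/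
def derivForm (x : W.K) (v : E3) : Module.Dual ℝ (C1 W.K) where
  toFun f := fderivWithin ℝ (ext f.1) W.K x v
  map_add' f g := by
    have hf := (f.2.differentiableOn one_ne_zero) x x.2
    have hg := (g.2.differentiableOn one_ne_zero) x x.2
    have h : ext (f + g).1 = ext f.1 + ext g.1 := ext_add f.1 g.1
    rw [h, fderivWithin_add (W.uniqueDiffOn x x.2) hf hg]
    rfl
  map_smul' a f := by
    have hf := (f.2.differentiableOn one_ne_zero) x x.2
    have h : ext (a • f).1 = a • ext f.1 := ext_smul a f.1
    rw [h, fderivWithin_const_smul (W.uniqueDiffOn x x.2) hf a]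
    rfl

end Partition

/-- Labels of the degrees of freedom: `μ` for the value at `Q_μ`, `(ℓ, μ)` for the `ℓ`-th partial
derivative at `Q_μ`, and `(e, i)` for the derivative in direction `ν_e,i` at the midpoint of `e`. -/
abbrev DofLabel : Type := Fin 4 ⊕ (Fin 3 × Fin 4) ⊕ (Edge × Fin 2)

/-- The numbering of the degrees of freedom. With indices starting from one, it assigns the number
`μ`, `4 ℓ + μ`, and `20 - 2 ^ (4 - j) + 2 k + m` to the labels `μ`, `(ℓ, μ)`, and `((j, k), m)`. -/
def dofNumberAux : DofLabel → Fin 28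
  | .inl μ => Fin.ofNat 28 μ
  | .inr (.inl (l, μ)) => Fin.ofNat 28 (4 * (l + 1) + μ)
  | .inr (.inr (e, i)) => Fin.ofNat 28 (20 - 2 ^ (3 - (e.1.1 : ℕ)) + 2 * (e.1.2 + 1) + i)

theorem dofNumberAux_bijective : Function.Bijective dofNumberAux := by decide

/-- The numbering of the degrees of freedom as a bijection. -/
def dofNumber : DofLabel ≃ Fin 28 := Equiv.ofBijective dofNumberAux dofNumberAux_bijective

namespace Partition

variable (W : Partition)

/-- The degree of freedom with a given label, on `C¹(K)`. -/
def labelledDof {W : Partition} (ν : W.EdgeNormals) : DofLabel → Module.Dual ℝ (C1 W.K)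
  | .inl μ => W.evalForm ⟨W.Q μ, W.Q_mem μ⟩
  | .inr (.inl (l, μ)) => W.derivForm ⟨W.Q μ, W.Q_mem μ⟩ (EuclideanSpace.single l 1)
  | .inr (.inr (e, i)) => W.derivForm ⟨W.mid e, W.mid_mem e⟩ (ν.vec e i)

/-- The degrees of freedom `L_1, …, L_28` on `C¹(K) ∩ P_3(WF3D(K))`. -/
def dof {W : Partition} (ν : W.EdgeNormals) (μ : Fin 28) : Module.Dual ℝ W.space :=
  (labelledDof ν (dofNumber.symm μ)).comp (Submodule.inclusion inf_le_left)

/-! ### Algorithm WF-CT3D -/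

/-- A local enumeration of the vertices of the subtetrahedra fixes, for each of them, the order of
its vertices `Q_j`, `Q_k`. -/
abbrev LocalEnum : Type := SubTet → Equiv.Perm (Fin 2)

/-- The vertices `(c_K, c_m, Q_j, Q_k)` or `(c_K, c_m, Q_k, Q_j)` of a subtetrahedron, in the order
given by the local enumeration. -/
def vertices (σ : LocalEnum) (t : SubTet) : Fin 4 → E3 :=
  ![W.cK, W.c t.1.2, W.Q (![t.1.1.1.1, t.1.1.1.2] (σ t 0)), W.Q (![t.1.1.1.1, t.1.1.1.2] (σ t 1))]

/-- The families `(c_T(α) : T ∈ WF3D(K), α ∈ A_3)`. -/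
abbrev Ordinates : Type := SubTet → MultiIndex 4 3 → ℝ

/-- The input value `f(Q_μ)`. -/
def vertexValue (x : Fin 28 → ℝ) (μ : Fin 4) : ℝ := x (dofNumber (.inl μ))

/-- The input value `∇f(Q_μ)`. -/
def vertexGrad (x : Fin 28 → ℝ) (μ : Fin 4) : E3 :=
  WithLp.toLp 2 fun l => x (dofNumber (.inr (.inl (l, μ))))

/-- Step (a), preprocessing: `v e` and `G e` are the values for `f` and `∇f` at the midpoint of the
edge `e = (j, k)` computed from the input `x`. Here `p` is the cubic Hermite interpolation on the
edge, parametrized by `t ↦ Q_j + t (Q_k - Q_j)` for `0 ≤ t ≤ 1`. -/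
def IsPreprocessed {W : Partition} (ν : W.EdgeNormals) (x : Fin 28 → ℝ) (v : Edge → ℝ)
    (G : Edge → E3) : Prop :=
  ∀ e : Edge,
    (∃ p : Polynomial ℝ, p.natDegree ≤ 3 ∧
      p.eval 0 = vertexValue x e.1.1 ∧ p.eval 1 = vertexValue x e.1.2 ∧
      p.derivative.eval 0 = inner ℝ (vertexGrad x e.1.1) (W.edgeVec e) ∧
      p.derivative.eval 1 = inner ℝ (vertexGrad x e.1.2) (W.edgeVec e) ∧
      v e = p.eval (1 / 2) ∧ inner ℝ (G e) (W.edgeVec e) = p.derivative.eval (1 / 2)) ∧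
    ∀ i : Fin 2, inner ℝ (G e) (ν.vec e i) = x (dofNumber (.inr (.inr (e, i))))

/-- Step (b): `g` is the quadratic Lagrange interpolation in `K`. -/
def IsQuadraticInterpolation (x : Fin 28 → ℝ) (v : Edge → ℝ) (G : Edge → E3)
    (g : MvPolynomial (Fin 3) ℝ) : Prop :=
  g.totalDegree ≤ 2 ∧
  (∀ l : Fin 4, polyVal g (W.Q l) =
    vertexValue x l - 1 / 3 * inner ℝ (W.Q l - W.cK) (vertexGrad x l)) ∧
  ∀ e : Edge, polyVal g (W.mid e) = 1 / 3 * inner ℝ (W.cK - W.mid e) (G e) + v e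

/-- The function `h` on `F` is differentiable at `y` (relative to `F`), with derivative `d` in
direction `s`. For a triangle `F`, `y ∈ F`, and a vector `s` parallel to `F` the number `d` is unique:
two derivatives relative to `F` agree on the vectors parallel to `F`. -/
def HasDirDerivWithin (h : E3 → ℝ) (F : Set E3) (y s : E3) (d : ℝ) : Prop :=
  ∃ D : E3 →L[ℝ] ℝ, HasFDerivWithinAt h D F y ∧ D s = d

/-- Step (c): `h` (only its values on `F_m` matter) is the two-dimensional HCT interpolation on the
face `F_m` of `K`. It is `C¹` on `F_m`, cubic on the three triangles with vertices `c_m`, `Q_j`, `Q_k`,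
interpolates the values and tangential derivatives in the vertices of `F_m` and, in the midpoint of
each edge of `F_m`, the derivative in the direction parallel to `F_m` and perpendicular to the
edge. -/
def IsHCTInterpolation (x : Fin 28 → ℝ) (G : Edge → E3) (m : Fin 4) (h : E3 → ℝ) : Prop :=
  ContDiffOn ℝ 1 h (W.face m) ∧
  (∀ e : Edge, m ≠ e.1.1 → m ≠ e.1.2 → ∃ p : MvPolynomial (Fin 3) ℝ, p.totalDegree ≤ 3 ∧
    ∀ y ∈ convexHull ℝ {W.c m, W.Q e.1.1, W.Q e.1.2}, h y = polyVal p y) ∧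
  (∀ l : Fin 4, l ≠ m → h (W.Q l) = vertexValue x l ∧
    ∀ s ∈ W.faceDirection m,
      HasDirDerivWithin h (W.face m) (W.Q l) s (inner ℝ (vertexGrad x l) s)) ∧
  ∀ e : Edge, m ≠ e.1.1 → m ≠ e.1.2 →
    ∀ s ∈ W.faceDirection m, inner ℝ s (W.edgeVec e) = (0 : ℝ) →
      HasDirDerivWithin h (W.face m) (W.mid e) s (inner ℝ (G e) s)

/-- `f|_T = 6 ∑_{|α| = 3} c_T(α) w^α / α!` at `y = ∑ w_i P_i ∈ T` for each subtetrahedron `T` with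
(ordered) vertices `P_1, …, P_4`. -/
def HasOrdinates (σ : LocalEnum) (c : Ordinates) (f : W.K → ℝ) : Prop :=
  ∀ (t : SubTet) (w : Fin 4 → ℝ), (∀ i, 0 ≤ w i) → ∑ i, w i = 1 →
    ∀ y : W.K, (y : E3) = ∑ i, w i • W.vertices σ t i → f y = bernstein (c t) w

/-- Algorithm WF-CT3D with input `x` computes the ordinates `c` and the function `f`. In step (b)
the ordinates with first index at least one are those of the quadratic polynomial `g`; in step
(c) the ordinates with first index zero are those of the HCT functions on the faces (there the first
barycentric coordinate vanishes, so that `bernstein` only sees those ordinates). -/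
def IsAlgorithmOutput {W : Partition} (ν : W.EdgeNormals) (σ : LocalEnum) (x : Fin 28 → ℝ)
    (c : Ordinates) (f : W.K → ℝ) : Prop :=
  ∃ (v : Edge → ℝ) (G : Edge → E3) (g : MvPolynomial (Fin 3) ℝ) (h : Fin 4 → E3 → ℝ),
    IsPreprocessed ν x v G ∧
    (W.IsQuadraticInterpolation x v G g ∧
      ∀ (t : SubTet) (w : Fin 4 → ℝ), (∀ i, 0 ≤ w i) → ∑ i, w i = 1 →
        polyVal g (∑ i, w i • W.vertices σ t i) =
          bernstein (fun β : MultiIndex 4 2 => c t (β.addUnit 0)) w) ∧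
    (∀ m, W.IsHCTInterpolation x G m (h m)) ∧
    (∀ (t : SubTet) (w : Fin 4 → ℝ), (∀ i, 0 ≤ w i) → ∑ i, w i = 1 → w 0 = 0 →
        h t.1.2 (∑ i, w i • W.vertices σ t i) = bernstein (c t) w) ∧
    W.HasOrdinates σ c f

end Partition

end WorseyFarin

end

/-!
A `C¹` function which is piecewise cubic on the Worsey-Farin partition is studied through the blossoms
(symmetric trilinear polar forms) of its pieces. If `f` is differentiable at `x` with derivative `D_x`,
then every cubic piece containing `x` has a blossom `b` with
`b(x, x, Z) = f(x) + D_x(Z - x) / 3` for the vertices `Z` of the piece. The right-hand side (`jet`) does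
not refer to the piece. Polarizing it in `x` (`polar`), one finds that all ordinates of all pieces
are values of a single function `J(X, Y, Z)`, which is affine in `Z`, symmetric in `X, Y`, and fully
symmetric on the vertices of each piece (`polar_eq`, `IsCubicOn.polar_swap`).

*Uniqueness.* If all degrees of freedom of `f` vanish, then so do the derivatives at the vertices and at
the midpoints of the edges, that is `J(Q_j, Q_k, Z) = 0` for all `Z`. By symmetry
`J(c_K, Q_j, Q_k) = 0` and `J(c_m, Q_j, Q_k) = 0`. Since `c_K` and `c_m` are affine combinations of the
vertices `Q_l`, the remaining ordinates vanish one after the other (`trilinear_eq_zero`). The same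
argument within a face gives the uniqueness of the Hsieh-Clough-Tocher interpolation
(`face_trilinear_eq_zero`, `hct_eq_zero`).

*Existence.* Let `B_jj(Z) = f(Q_j) + ∇f(Q_j) · (Z - Q_j) / 3`, and let `B_jk(Z)` be the polarization of
the corresponding affine functions at the endpoints and the midpoint of the edge. Extended to
barycentric coordinates, this is a trilinear form `B(X, Y, Z)`, symmetric in `X, Y`. The
relations above leave only one candidate for the blossom of each piece: `b(c_K, Y, Z) = B(Y, Z, c_K)`
for all `Y, Z`, and `b(c_m, Y, Z) = B(Y, Z, c_m)` for `Y, Z` in the face, and `b(Q_j, Q_k, Z) = B_jk(Z)`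
for the edge of the piece. In closed form this is `polarForm`, applied to the decomposition
`x = τ c_K + ρ c_m + e`. One third of the derivative at `x` involves the piece only through the
decomposition of `x`, except for terms which vanish where several pieces meet
(`polarForm_congr`, `pieceDeriv_eq`). Hence the pieces form a `C¹` function (`exists_glue`), its ordinates
with first index at least one are those of the quadratic polynomial `B(x, x, c_K)`, and it is an output
of the algorithm (`exists_isAlgorithmOutput`). Every step of the algorithm is uniquely solvable
(`IsAlgorithmOutput.unique`), so that this is the only output.

The Lipschitz property of the boundary of the tetrahedron follows from its description by the
inequalities `λ_j ≥ 0` for the barycentric coordinates.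
-/

noncomputable section

namespace WorseyFarin

/-! ### Bernstein polynomials -/

theorem MultiIndex.sum_eq {m k : ℕ} (α : MultiIndex m k) : ∑ i, α.1 i = k :=
  (Finset.mem_piAntidiag.1 α.2).1

theorem MultiIndex.exists_addUnit {m k : ℕ} (α : MultiIndex m (k + 1)) (i : Fin m)
    (h : α.1 i ≠ 0) : ∃ β : MultiIndex m k, β.addUnit i = α := by
  have hs : Pi.single i 1 + (α.1 - Pi.single i 1) = α.1 := by
    funext j
    rcases eq_or_ne j i with rfl | hj
    · simp only [Pi.add_apply, Pi.single_eq_same, Pi.sub_apply]; omega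
    · simp [Pi.single_eq_of_ne hj]
  refine ⟨⟨α.1 - Pi.single i 1, ?_⟩, Subtype.ext hs⟩
  have h2 : ∑ j, (Pi.single i 1 + (α.1 - Pi.single i 1) : Fin m → ℕ) j = k + 1 := by
    rw [hs, α.sum_eq]
  simp only [Pi.add_apply, Finset.sum_add_distrib, Finset.sum_pi_single', Finset.mem_univ,
    if_true] at h2
  rw [Finset.mem_piAntidiag]
  exact ⟨Nat.add_left_cancel (h2.trans (add_comm k 1)), fun _ _ => Finset.mem_univ _⟩

theorem MultiIndex.addUnit_injective {m k : ℕ} (i : Fin m) :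
    Function.Injective (MultiIndex.addUnit i : MultiIndex m k → MultiIndex m (k + 1)) := by
  intro β γ h
  exact Subtype.ext (add_left_cancel (congrArg Subtype.val h))

theorem MultiIndex.addUnit_comm {m k : ℕ} (i j : Fin m) (β : MultiIndex m k) :
    (β.addUnit i).addUnit j = (β.addUnit j).addUnit i :=
  Subtype.ext (add_left_comm _ _ _)

/-- The ordinates `c(e_i + β)`. Up to a factor, they belong to the `i`-th partial derivative. -/
def shift {m k : ℕ} (c : MultiIndex m (k + 1) → ℝ) (i : Fin m) : MultiIndex m k → ℝ :=
  fun β => c (β.addUnit i)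

theorem shift_comm {m k : ℕ} (c : MultiIndex m (k + 2) → ℝ) (i j : Fin m) :
    shift (shift c i) j = shift (shift c j) i := by
  funext β
  simp only [shift, MultiIndex.addUnit_comm]

theorem bernstein_zero {m : ℕ} (c : MultiIndex m 0 → ℝ) (w : Fin m → ℝ) (α : MultiIndex m 0) :
    bernstein c w = c α := by
  have h0 : ∀ β : MultiIndex m 0, β.1 = 0 := fun β => by
    have := β.sum_eq
    rw [Finset.sum_eq_zero_iff] at this
    funext i; exact this i (Finset.mem_univ i)
  have hu : ∀ β : MultiIndex m 0, β = α := fun β => Subtype.ext ((h0 β).trans (h0 α).symm)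
  rw [bernstein, Fintype.sum_eq_single α (fun β hβ => absurd (hu β) hβ), h0 α]
  simp

/-- One step of the de Casteljau recursion, with symbolic coefficients: Euler's identity for the
Bernstein form. -/
theorem bernstein_succ {m k : ℕ} (c : MultiIndex m (k + 1) → ℝ) (w : Fin m → ℝ) :
    bernstein c w = ∑ i, w i * bernstein (shift c i) w := by
  set M : (Fin m → ℕ) → ℝ := fun α => ∏ i, w i ^ α i / ((α i).factorial : ℝ) with hM
  have key : ∀ (i : Fin m) (β : MultiIndex m k),
      (((β.addUnit i).1 i : ℕ) : ℝ) * M (β.addUnit i).1 = w i * M β.1 := by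
    intro i β
    have h1 : ∀ j ∈ Finset.univ.erase i, (β.addUnit i).1 j = β.1 j := by
      intro j hj
      simp [MultiIndex.addUnit, Pi.single_eq_of_ne (Finset.ne_of_mem_erase hj)]
    have h2 : (β.addUnit i).1 i = β.1 i + 1 := by simp [MultiIndex.addUnit, add_comm]
    simp only [hM]
    rw [← Finset.mul_prod_erase _ _ (Finset.mem_univ i),
      ← Finset.mul_prod_erase (a := i) Finset.univ (fun j => w j ^ β.1 j / _) (Finset.mem_univ i),
      Finset.prod_congr rfl (fun j hj => by rw [h1 j hj]), h2, Nat.factorial_succ]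
    have : ((β.1 i).factorial : ℝ) ≠ 0 := by positivity
    push_cast
    field_simp
    ring
  have h3 : ∀ i, ∑ β : MultiIndex m k, c (β.addUnit i) * (w i * M β.1) =
      ∑ α : MultiIndex m (k + 1), c α * ((α.1 i : ℝ) * M α.1) := by
    intro i
    refine Fintype.sum_of_injective (MultiIndex.addUnit i) (MultiIndex.addUnit_injective i) _ _
      (fun α hα => ?_) (fun β => by rw [key])
    by_cases h : α.1 i = 0
    · simp [h]
    · obtain ⟨β, rfl⟩ := α.exists_addUnit i h
      exact absurd ⟨β, rfl⟩ hα
  have h4 : ∀ i, w i * bernstein (shift c i) w =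
      (k.factorial : ℝ) * ∑ α : MultiIndex m (k + 1), c α * ((α.1 i : ℝ) * M α.1) := by
    intro i
    rw [← h3, bernstein, mul_left_comm, Finset.mul_sum]
    congr 1
    refine Finset.sum_congr rfl fun β _ => ?_
    simp only [shift, hM]; ring
  rw [Finset.sum_congr rfl (fun i _ => h4 i), ← Finset.mul_sum, Finset.sum_comm, bernstein,
    Nat.factorial_succ, Nat.cast_mul, mul_assoc, mul_left_comm, Finset.mul_sum]
  congr 1
  refine Finset.sum_congr rfl fun α _ => ?_
  rw [← Finset.mul_sum, ← Finset.sum_mul, ← Nat.cast_sum, α.sum_eq]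
  simp only [hM]; ring

/-- The derivative of a polynomial in Bernstein form along a line. -/
theorem hasDerivAt_bernstein {m k : ℕ} (c : MultiIndex m (k + 1) → ℝ) (w z : Fin m → ℝ) (s : ℝ) :
    HasDerivAt (fun s : ℝ => bernstein c (w + s • z))
      ((k + 1) * ∑ i, z i * bernstein (shift c i) (w + s • z)) s := by
  induction k with
  | zero =>
    have h : ∀ (i : Fin m) (u v : Fin m → ℝ), bernstein (shift c i) u = bernstein (shift c i) v :=
      fun i u v => by
        rw [bernstein_zero _ u ⟨0, by simp⟩,
          bernstein_zero _ v ⟨0, by simp⟩]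
    have h1 : (fun s : ℝ => bernstein c (w + s • z)) =
        fun s : ℝ => ∑ i, (w i + s * z i) * bernstein (shift c i) w := by
      funext s
      rw [bernstein_succ]
      exact Finset.sum_congr rfl fun i _ => by rw [h i (w + s • z) w]; simp
    rw [h1]
    have h2 : HasDerivAt (fun s : ℝ => ∑ i, (w i + s * z i) * bernstein (shift c i) w)
        (∑ i, z i * bernstein (shift c i) w) s := by
      refine HasDerivAt.fun_sum fun i _ => ?_
      simpa using (((hasDerivAt_id s).mul_const (z i)).const_add (w i)).mul_const _
    convert! h2 using 1
    simp only [Nat.cast_zero, zero_add, one_mul]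
    exact Finset.sum_congr rfl fun i _ => by rw [h i]
  | succ k ih =>
    have h1 : (fun s : ℝ => bernstein c (w + s • z)) =
        fun s : ℝ => ∑ i, (w i + s * z i) * bernstein (shift c i) (w + s • z) := by
      funext s
      rw [bernstein_succ]
      simp
    rw [h1]
    have h2 : HasDerivAt
        (fun s : ℝ => ∑ i, (w i + s * z i) * bernstein (shift c i) (w + s • z))
        (∑ i, (z i * bernstein (shift c i) (w + s • z) + (w i + s * z i) *
          ((k + 1) * ∑ j, z j * bernstein (shift (shift c i) j) (w + s • z)))) s := by
      refine HasDerivAt.fun_sum fun i _ => ?_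
      have h3 : HasDerivAt (fun s : ℝ => w i + s * z i) (z i) s := by
        simpa using ((hasDerivAt_id s).mul_const (z i)).const_add (w i)
      exact h3.mul (ih (shift c i))
    convert! h2 using 1
    rw [Finset.sum_add_distrib, Finset.mul_sum]
    have h4 : ∑ i, (w i + s * z i) *
          ((k + 1) * ∑ j, z j * bernstein (shift (shift c i) j) (w + s • z)) =
        (k + 1) * ∑ j, z j * bernstein (shift c j) (w + s • z) := by
      simp only [bernstein_succ (shift c _) (w + s • z), Finset.mul_sum]
      rw [Finset.sum_comm]
      refine Finset.sum_congr rfl fun j _ => Finset.sum_congr rfl fun i _ => ?_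
      rw [shift_comm]
      simp only [Pi.add_apply, Pi.smul_apply, smul_eq_mul]
      ring
    rw [h4, ← Finset.mul_sum]
    push_cast
    ring

/-- At a point `x` of a simplex on which `f` has a Bernstein form, the derivative of `f` relative to any
larger set `S` is determined in the directions of the vertices, by one-sided differentiation along the
segment from `x` to the vertex. -/
theorem hasFDerivWithinAt_bernstein {n k : ℕ} {P : Fin n → E3} {S : Set E3}
    {f : E3 → ℝ} {D : E3 →L[ℝ] ℝ} {c : MultiIndex n (k + 1) → ℝ}
    (hPS : convexHull ℝ (range P) ⊆ S)
    (hf : ∀ w : Fin n → ℝ, (∀ i, 0 ≤ w i) → ∑ i, w i = 1 → f (∑ i, w i • P i) = bernstein c w)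
    {w : Fin n → ℝ} (hw : ∀ i, 0 ≤ w i) (hw1 : ∑ i, w i = 1)
    (hD : HasFDerivWithinAt f D S (∑ i, w i • P i)) (l : Fin n) :
    f (∑ i, w i • P i) + D (P l - ∑ i, w i • P i) / (k + 1) = bernstein (shift c l) w := by
  set x := ∑ i, w i • P i with hx
  have hmem : ∀ v : Fin n → ℝ, (∀ i, 0 ≤ v i) → ∑ i, v i = 1 → ∑ i, v i • P i ∈ S :=
    fun v h0 h1 => hPS ((convex_convexHull ℝ _).sum_mem (fun i _ => h0 i) h1
      (fun i _ => subset_convexHull ℝ _ (mem_range_self i)))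
  set z : Fin n → ℝ := Pi.single l 1 - w with hz
  have hnn : ∀ s ∈ Icc (0 : ℝ) 1, ∀ i, 0 ≤ (w + s • z) i := by
    intro s hs i
    have h1 : (w + s • z) i = (1 - s) * w i + s * (Pi.single l 1 : Fin n → ℝ) i := by
      simp [hz]; ring
    rw [h1]
    have h2 : 0 ≤ (Pi.single l 1 : Fin n → ℝ) i := by
      rcases eq_or_ne i l with rfl | h
      · simp
      · simp [Pi.single_eq_of_ne h]
    exact add_nonneg (mul_nonneg (by linarith [hs.2]) (hw i)) (mul_nonneg hs.1 h2)
  have hsum : ∀ s : ℝ, ∑ i, (w + s • z) i = 1 := by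
    intro s
    simp [hz, Finset.sum_add_distrib, ← Finset.mul_sum, hw1]
  have hpt : ∀ s : ℝ, ∑ i, (w + s • z) i • P i = x + s • (P l - x) := by
    intro s
    simp only [hz, Pi.add_apply, Pi.smul_apply, Pi.sub_apply, smul_eq_mul, add_smul, mul_smul,
      sub_smul, Finset.sum_add_distrib, ← Finset.smul_sum, Finset.sum_sub_distrib, ← hx]
    congr 3
    rw [Finset.sum_eq_single l] <;> simp +contextual [Pi.single_eq_of_ne]
  have h1 : HasDerivWithinAt (fun s : ℝ => f (x + s • (P l - x))) (D (P l - x)) (Icc 0 1) 0 := by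
    have hl : HasDerivWithinAt (fun s : ℝ => x + s • (P l - x)) (P l - x) (Icc 0 1) 0 := by
      simpa using (((hasDerivAt_id (0 : ℝ)).smul_const (P l - x)).const_add x).hasDerivWithinAt
    refine HasFDerivWithinAt.comp_hasDerivWithinAt (t := S) 0 (by simpa using hD) hl ?_
    intro s hs
    simp only [← hpt]
    exact hmem _ (hnn s hs) (hsum s)
  have h2 := (hasDerivAt_bernstein c w z 0).hasDerivWithinAt (s := Icc 0 1)
  have h3 : HasDerivWithinAt (fun s : ℝ => f (x + s • (P l - x)))
      ((k + 1) * ∑ i, z i * bernstein (shift c i) (w + (0 : ℝ) • z)) (Icc 0 1) 0 := by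
    refine h2.congr (fun s hs => ?_) ?_
    · rw [← hpt, hf _ (hnn s hs) (hsum s)]
    · rw [← hpt, hf _ (hnn 0 (by simp)) (hsum 0)]
  have h4 := (uniqueDiffOn_Icc (zero_lt_one' ℝ) 0 (by simp)).eq_deriv _ h1 h3
  rw [h4, zero_smul, add_zero, hx, hf w hw hw1, bernstein_succ]
  have h5 : ((k : ℝ) + 1) ≠ 0 := by positivity
  rw [mul_div_cancel_left₀ _ h5, ← Finset.sum_add_distrib, Finset.sum_eq_single l]
  · simp [hz]; ring
  · intro i _ hi; simp [hz, Pi.single_eq_of_ne hi]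
  · simp

/-- A polynomial in Bernstein form which vanishes on a face of the simplex has vanishing ordinates on
this face. The set `A` contains the indices of the vertices of the face. The proof differentiates the
polynomial in the directions of these vertices. -/
theorem bernstein_eq_zero {m k : ℕ} {A : Set (Fin m)} (hA : A.Nonempty)
    {c : MultiIndex m k → ℝ}
    (h : ∀ w : Fin m → ℝ, (∀ i, 0 ≤ w i) → ∑ i, w i = 1 → (∀ i ∉ A, w i = 0) → bernstein c w = 0)
    (α : MultiIndex m k) (hα : ∀ i ∉ A, α.1 i = 0) : c α = 0 := by
  induction k with
  | zero =>
    obtain ⟨a, ha⟩ := hA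
    rw [← bernstein_zero c (Pi.single a 1) α]
    refine h _ (fun i => ?_) (by simp) (fun i hi => Pi.single_eq_of_ne (by rintro rfl; exact hi ha) _)
    rcases eq_or_ne i a with rfl | h
    · simp
    · simp [Pi.single_eq_of_ne h]
  | succ k ih =>
    have : ∃ l, α.1 l ≠ 0 := by
      by_contra! h0
      have := α.sum_eq
      simp [h0] at this
    obtain ⟨l, hl⟩ := this
    have hlA : l ∈ A := by by_contra hA'; exact hl (hα l hA')
    obtain ⟨β, rfl⟩ := α.exists_addUnit l hl
    refine ih (c := shift c l) (fun w hw hw1 hwA => ?_) β (fun i hi => ?_)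
    · have hd := hasDerivAt_bernstein c w (Pi.single l 1 - w) 0
      have hz : ∀ s ∈ Icc (0 : ℝ) 1,
          bernstein c (w + s • (Pi.single l 1 - w)) = 0 := by
        intro s hs
        have h1 : ∀ i, (w + s • (Pi.single l 1 - w) : Fin m → ℝ) i =
            (1 - s) * w i + s * (Pi.single l 1 : Fin m → ℝ) i := by
          intro i; simp; ring
        refine h _ (fun i => ?_) ?_ (fun i hi => ?_)
        · rw [h1]
          have h2 : 0 ≤ (Pi.single l 1 : Fin m → ℝ) i := by
            rcases eq_or_ne i l with rfl | h
            · simp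
            · simp [Pi.single_eq_of_ne h]
          exact add_nonneg (mul_nonneg (by linarith [hs.2]) (hw i)) (mul_nonneg hs.1 h2)
        · simp [Finset.sum_add_distrib, ← Finset.mul_sum, hw1]
        · rw [h1, hwA i hi, Pi.single_eq_of_ne (by rintro rfl; exact hi hlA)]; simp
      have h3 : HasDerivWithinAt (fun s : ℝ => bernstein c (w + s • (Pi.single l 1 - w))) 0
          (Icc 0 1) 0 :=
        (hasDerivWithinAt_const (0 : ℝ) (Icc 0 1) (0 : ℝ)).congr hz (hz 0 (by simp))
      have h4 := (uniqueDiffOn_Icc (zero_lt_one' ℝ) 0 (by simp)).eq_deriv _ h3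
        hd.hasDerivWithinAt
      have h5 : ((k : ℝ) + 1) ≠ 0 := by positivity
      have h6 := (mul_eq_zero.1 h4.symm).resolve_left h5
      have h7 : bernstein c w = 0 := by simpa using hz 0 (by simp)
      rw [bernstein_succ] at h7
      rw [zero_smul, add_zero] at h6
      have h8 := congrArg₂ (· + ·) h6 h7
      simp only [← Finset.sum_add_distrib, add_zero] at h8
      rw [Finset.sum_eq_single l] at h8
      · simp only [Pi.sub_apply, Pi.single_eq_same] at h8
        linarith
      · intro i _ hi; simp [Pi.single_eq_of_ne hi]
      · simp
    · have := hα i hi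
      simp only [MultiIndex.addUnit, Pi.add_apply] at this
      omega

theorem bernstein_sub {m k : ℕ} (c c' : MultiIndex m k → ℝ) (w : Fin m → ℝ) :
    bernstein (c - c') w = bernstein c w - bernstein c' w := by
  simp only [bernstein, Pi.sub_apply, sub_mul, Finset.sum_sub_distrib, mul_sub]

theorem exists_bernstein_eq_eval {m k : ℕ} {q : MvPolynomial (Fin m) ℝ} (hq : q.IsHomogeneous k) :
    ∃ c : MultiIndex m k → ℝ, ∀ w, MvPolynomial.eval w q = bernstein c w := by
  refine ⟨fun α => q.coeff (Finsupp.equivFunOnFinite.symm α.1) *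
    (∏ i, ((α.1 i).factorial : ℝ)) / k.factorial, fun w => ?_⟩
  rw [MvPolynomial.eval_eq', bernstein, Finset.mul_sum]
  have hk : (k.factorial : ℝ) ≠ 0 := by positivity
  have h1 : ∀ α : MultiIndex m k, (k.factorial : ℝ) *
      (q.coeff (Finsupp.equivFunOnFinite.symm α.1) * (∏ i, ((α.1 i).factorial : ℝ)) / k.factorial *
        ∏ i, w i ^ α.1 i / ((α.1 i).factorial : ℝ)) =
      q.coeff (Finsupp.equivFunOnFinite.symm α.1) * ∏ i, w i ^ α.1 i := by
    intro α
    rw [Finset.prod_div_distrib]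
    have : (∏ i, ((α.1 i).factorial : ℝ)) ≠ 0 := Finset.prod_ne_zero_iff.2 fun i _ => by positivity
    field_simp
  simp only [h1]
  symm
  rw [← Finset.sum_coe_sort q.support]
  symm
  refine Fintype.sum_of_injective
    (fun d : q.support => (⟨Finsupp.equivFunOnFinite d.1, ?_⟩ : MultiIndex m k)) ?_ _ _ ?_ ?_
  · rw [Finset.mem_piAntidiag]
    refine ⟨?_, fun _ _ => Finset.mem_univ _⟩
    have := hq (MvPolynomial.mem_support_iff.1 d.2)
    simpa [Finsupp.weight_apply, Finsupp.sum_fintype] using this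
  · intro d e h
    exact Subtype.ext (Finsupp.equivFunOnFinite.injective (congrArg Subtype.val h))
  · intro α hα
    by_cases h : q.coeff (Finsupp.equivFunOnFinite.symm α.1) = 0
    · simp [h]
    · exact absurd ⟨⟨_, MvPolynomial.mem_support_iff.2 h⟩, by simp⟩ hα
  · intro d
    simp

/-- Every polynomial of degree at most `k` has a Bernstein form of degree `k` with respect to given
points: in barycentric coordinates, the components of lower degree are made homogeneous by powers of the
sum of the coordinates. -/
theorem exists_ordinates {m k : ℕ} (p : MvPolynomial (Fin 3) ℝ) (hp : p.totalDegree ≤ k)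
    (P : Fin m → E3) : ∃ c : MultiIndex m k → ℝ, ∀ w : Fin m → ℝ, ∑ i, w i = 1 →
      polyVal p (∑ i, w i • P i) = bernstein c w := by
  set L : Fin 3 → MvPolynomial (Fin m) ℝ := fun l => ∑ i, MvPolynomial.C (P i l) * MvPolynomial.X i
  have hL : ∀ l, (L l).IsHomogeneous 1 := fun l =>
    MvPolynomial.IsHomogeneous.sum _ _ _ fun i _ => MvPolynomial.isHomogeneous_C_mul_X _ _
  set q : MvPolynomial (Fin m) ℝ := ∑ d ∈ Finset.range (k + 1),
    MvPolynomial.aeval L (MvPolynomial.homogeneousComponent d p) *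
      (∑ i, MvPolynomial.X i) ^ (k - d) with hqdef
  have hq : q.IsHomogeneous k := by
    refine MvPolynomial.IsHomogeneous.sum _ _ _ fun d hd => ?_
    have h1 := (MvPolynomial.homogeneousComponent_isHomogeneous d p).aeval L hL
    have h2 : (∑ i, MvPolynomial.X i : MvPolynomial (Fin m) ℝ).IsHomogeneous 1 :=
      MvPolynomial.IsHomogeneous.sum _ _ _ fun i _ => MvPolynomial.isHomogeneous_X _ _
    have h3 := h1.mul (h2.pow (k - d))
    have h4 : 1 * d + 1 * (k - d) = k := by
      have := Finset.mem_range.1 hd; omega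
    rwa [h4] at h3
  obtain ⟨c, hc⟩ := exists_bernstein_eq_eval hq
  refine ⟨c, fun w hw => ?_⟩
  have hev : ∀ r : MvPolynomial (Fin 3) ℝ, MvPolynomial.eval w (MvPolynomial.aeval L r) =
      polyVal r (∑ i, w i • P i) := by
    intro r
    rw [polyVal]
    have : (MvPolynomial.eval w).comp (MvPolynomial.aeval L : _ →ₐ[ℝ] _).toRingHom =
        MvPolynomial.eval (fun l => (∑ i, w i • P i : E3) l) := by
      refine MvPolynomial.ringHom_ext (fun a => ?_) (fun l => ?_)
      · simp
      · simp [L, mul_comm]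
    exact DFunLike.congr_fun this r
  rw [← hc, hqdef, map_sum]
  simp only [map_mul, map_pow, map_sum, MvPolynomial.eval_X, hw, one_pow, mul_one, hev]
  have hsum : p = ∑ d ∈ Finset.range (k + 1), MvPolynomial.homogeneousComponent d p := by
    conv_lhs => rw [← MvPolynomial.sum_homogeneousComponent p]
    refine Finset.sum_subset (Finset.range_mono (by omega)) fun d _ hd => ?_
    exact MvPolynomial.homogeneousComponent_eq_zero _ _ (by simpa using hd)
  conv_lhs => rw [hsum]
  simp only [polyVal, map_sum]

/-! ### Polarization of the first-order jets of a piecewise cubic function -/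

/-- For `Z` in `ℝ³`, the value `f(x) + D_x(Z - x) / 3`. If `f` is a cubic polynomial with blossom
`b` and derivative `D`, this is `b(x, x, Z)`. -/
def jet (f : E3 → ℝ) (D : E3 → E3 →L[ℝ] ℝ) (x Z : E3) : ℝ := f x + D x (Z - x) / 3

/-- The polarization of `jet` in its first argument. If `f` is a cubic polynomial with
derivative `D`, this is its blossom. -/
def polar (f : E3 → ℝ) (D : E3 → E3 →L[ℝ] ℝ) (x y Z : E3) : ℝ :=
  (4 * jet f D ((1 / 2 : ℝ) • (x + y)) Z - jet f D x Z - jet f D y Z) / 2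

section Polar

variable {f : E3 → ℝ} {D : E3 → E3 →L[ℝ] ℝ}

theorem polar_comm (x y Z : E3) : polar f D x y Z = polar f D y x Z := by
  rw [polar, polar, add_comm x y]; ring

theorem polar_self (x Z : E3) : polar f D x x Z = jet f D x Z := by
  have : (1 / 2 : ℝ) • (x + x) = x := by module
  rw [polar, this]; ring

theorem jet_sum {n : ℕ} (x : E3) (P : Fin n → E3) {w : Fin n → ℝ} (hw : ∑ i, w i = 1) :
    jet f D x (∑ i, w i • P i) = ∑ i, w i * jet f D x (P i) := by
  have h : ∑ i, w i • P i - x = ∑ i, w i • (P i - x) := by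
    simp only [smul_sub, Finset.sum_sub_distrib, ← Finset.sum_smul, hw, one_smul]
  simp only [jet, h, map_sum, map_smul, smul_eq_mul, mul_add, Finset.sum_add_distrib,
    ← Finset.sum_mul, hw, one_mul, Finset.sum_div, mul_div_assoc]

theorem polar_sum {n : ℕ} (x y : E3) (P : Fin n → E3) {w : Fin n → ℝ} (hw : ∑ i, w i = 1) :
    polar f D x y (∑ i, w i • P i) = ∑ i, w i * polar f D x y (P i) := by
  simp only [polar, jet_sum _ P hw, Finset.mul_sum, ← Finset.sum_sub_distrib, Finset.sum_div]
  exact Finset.sum_congr rfl fun i _ => by ring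

/-- The function `f` has a cubic Bernstein form on the simplex with vertices `P`. -/
def IsCubicOn {n : ℕ} (f : E3 → ℝ) (P : Fin n → E3) : Prop :=
  ∃ c : MultiIndex n 3 → ℝ, ∀ w : Fin n → ℝ, (∀ i, 0 ≤ w i) → ∑ i, w i = 1 →
    f (∑ i, w i • P i) = bernstein c w

/-- The multi-index zero. -/
def zeroIndex (n : ℕ) : MultiIndex n 0 := ⟨0, by simp⟩

theorem bernstein_two {n : ℕ} (d : MultiIndex n 2 → ℝ) (w : Fin n → ℝ) :
    bernstein d w = ∑ i, w i * ∑ j, w j * shift (shift d i) j (zeroIndex n) := by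
  simp only [bernstein_succ, bernstein_zero _ w (zeroIndex n)]

theorem bernstein_two_polar {n : ℕ} (d : MultiIndex n 2 → ℝ) (i j : Fin n) :
    (4 * bernstein d ((1 / 2 : ℝ) • (Pi.single i 1 + Pi.single j 1)) -
      bernstein d (Pi.single i 1) - bernstein d (Pi.single j 1)) / 2 =
    shift (shift d i) j (zeroIndex n) := by
  have h := congrFun (shift_comm d i j) (zeroIndex n)
  simp only [bernstein_two, Pi.smul_apply, Pi.add_apply, smul_eq_mul, mul_assoc, ← Finset.mul_sum,
    add_mul, Finset.sum_add_distrib, mul_add, Pi.single_apply, ite_mul, one_mul, zero_mul,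
    Finset.sum_ite_eq', Finset.mem_univ, if_true]
  rw [← h]
  ring

theorem single_nonneg {n : ℕ} (i j : Fin n) : 0 ≤ (Pi.single i 1 : Fin n → ℝ) j := by
  rw [Pi.single_apply]; split_ifs <;> norm_num

theorem sum_single_smul {n : ℕ} (P : Fin n → E3) (i : Fin n) :
    ∑ j, (Pi.single i 1 : Fin n → ℝ) j • P j = P i := by
  simp [Pi.single_apply]

variable {n : ℕ} {P : Fin n → E3} {S : Set E3}

/-- The ordinates of a cubic piece of a differentiable function are values of `polar`, which does not
depend on the piece. -/
theorem polar_eq {c : MultiIndex n 3 → ℝ}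
    (hc : ∀ w : Fin n → ℝ, (∀ i, 0 ≤ w i) → ∑ i, w i = 1 →
      f (∑ i, w i • P i) = bernstein c w)
    (hD : ∀ x ∈ S, HasFDerivWithinAt f (D x) S x)
    (hPS : convexHull ℝ (range P) ⊆ S) (i j l : Fin n) :
    polar f D (P i) (P j) (P l) = shift (shift (shift c l) i) j (zeroIndex n) := by
  have key : ∀ w : Fin n → ℝ, (∀ i, 0 ≤ w i) → ∑ i, w i = 1 →
      jet f D (∑ i, w i • P i) (P l) = bernstein (shift c l) w := by
    intro w h0 h1
    have hx : ∑ i, w i • P i ∈ S := hPS ((convex_convexHull ℝ _).sum_mem (fun i _ => h0 i) h1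
      (fun i _ => subset_convexHull ℝ _ (mem_range_self i)))
    rw [← hasFDerivWithinAt_bernstein hPS hc h0 h1 (hD _ hx) l, jet]
    norm_num
  have h1 : ∀ i, jet f D (P i) (P l) = bernstein (shift c l) (Pi.single i 1) := by
    intro i
    rw [← key _ (single_nonneg i) (by simp), sum_single_smul]
  have h2 : jet f D ((1 / 2 : ℝ) • (P i + P j)) (P l) =
      bernstein (shift c l) ((1 / 2 : ℝ) • (Pi.single i 1 + Pi.single j 1)) := by
    rw [← key]
    · congr 1
      simp only [Pi.smul_apply, Pi.add_apply, smul_eq_mul, mul_smul, add_smul,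
        ← Finset.smul_sum, Finset.sum_add_distrib, sum_single_smul]
    · intro k
      have h2 := single_nonneg i k
      have h3 := single_nonneg j k
      simp only [Pi.smul_apply, Pi.add_apply, smul_eq_mul]
      linarith
    · simp only [Pi.smul_apply, Pi.add_apply, smul_eq_mul, ← Finset.mul_sum,
        Finset.sum_add_distrib, Finset.sum_pi_single', Finset.mem_univ, if_true]
      norm_num
  rw [polar, h1, h1, h2, ← bernstein_two_polar (shift c l) i j]

theorem IsCubicOn.polar_swap (hf : IsCubicOn f P) (hD : ∀ x ∈ S, HasFDerivWithinAt f (D x) S x)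
    (hPS : convexHull ℝ (range P) ⊆ S) {x y z : E3} (hx : x ∈ range P) (hy : y ∈ range P)
    (hz : z ∈ range P) : polar f D x y z = polar f D x z y := by
  obtain ⟨c, hc⟩ := hf
  obtain ⟨i, rfl⟩ := hx
  obtain ⟨j, rfl⟩ := hy
  obtain ⟨l, rfl⟩ := hz
  rw [polar_eq hc hD hPS, polar_eq hc hD hPS, shift_comm c l i,
    shift_comm (shift c i) l j, shift_comm c i j]

theorem IsCubicOn.eq_zero (hf : IsCubicOn f P) (hD : ∀ x ∈ S, HasFDerivWithinAt f (D x) S x)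
    (hPS : convexHull ℝ (range P) ⊆ S)
    (h0 : ∀ x ∈ range P, ∀ y ∈ range P, ∀ z ∈ range P, polar f D x y z = 0)
    {w : Fin n → ℝ} (hw : ∀ i, 0 ≤ w i) (hw1 : ∑ i, w i = 1) : f (∑ i, w i • P i) = 0 := by
  obtain ⟨c, hc⟩ := hf
  rw [hc w hw hw1, bernstein_succ]
  simp only [bernstein_two, ← polar_eq hc hD hPS, h0 _ (mem_range_self _) _ (mem_range_self _) _
    (mem_range_self _), mul_zero, Finset.sum_const_zero]

/-- Along an edge, the jet at the midpoint is determined by the jets at the endpoints. -/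
theorem IsCubicOn.jet_mid (hf : IsCubicOn f P) (hD : ∀ x ∈ S, HasFDerivWithinAt f (D x) S x)
    (hPS : convexHull ℝ (range P) ⊆ S) {x y : E3} (hx : x ∈ range P) (hy : y ∈ range P) :
    jet f D ((1 / 2 : ℝ) • (x + y)) x =
      (jet f D x x + 2 * jet f D x y + jet f D y x) / 4 := by
  have h := hf.polar_swap hD hPS hx hy hx
  rw [polar_self, polar] at h
  linarith

end Polar

namespace Partition

variable (W : Partition)

/-! ### Barycentric coordinates -/

/-- The vertices of the tetrahedron as an affine basis of `ℝ³`. -/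
def basis : AffineBasis (Fin 4) ℝ E3 :=
  ⟨W.Q, W.affineIndependent, by
    rw [W.affineIndependent.affineSpan_eq_top_iff_card_eq_finrank_add_one]; simp⟩

theorem basis_coe : ⇑W.basis = W.Q := rfl

theorem coord_sum {w : Fin 4 → ℝ} (hw : ∑ i, w i = 1) (j : Fin 4) :
    W.basis.coord j (∑ i, w i • W.Q i) = w j := by
  rw [← W.basis_coe, ← Finset.univ.affineCombination_eq_linear_combination _ _ hw,
    W.basis.coord_apply_combination_of_mem (Finset.mem_univ j) hw]

theorem sum_coord_smul (x : E3) : ∑ j, W.basis.coord j x • W.Q j = x :=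
  W.basis.linear_combination_coord_eq_self x

theorem sum_coord (x : E3) : ∑ j, W.basis.coord j x = 1 := W.basis.sum_coord_apply_eq_one x

theorem mem_K_iff (x : E3) : x ∈ W.K ↔ ∀ j, 0 ≤ W.basis.coord j x := by
  rw [K, ← W.basis_coe, W.basis.convexHull_eq_nonneg_coord]; rfl

theorem mem_interior_K_iff (x : E3) : x ∈ interior W.K ↔ ∀ j, 0 < W.basis.coord j x := by
  rw [K, ← W.basis_coe, W.basis.interior_convexHull]; rfl

theorem coord_cK_pos (j : Fin 4) : 0 < W.basis.coord j W.cK :=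
  (W.mem_interior_K_iff _).1 W.cK_mem j

theorem coord_c_self (m : Fin 4) : W.basis.coord m (W.c m) = 0 := by
  obtain ⟨w, h1, h2, -, h4⟩ := W.c_mem m
  rw [h4, W.coord_sum h1, h2]

theorem coord_c_pos {m j : Fin 4} (h : j ≠ m) : 0 < W.basis.coord j (W.c m) := by
  obtain ⟨w, h1, -, h3, h4⟩ := W.c_mem m
  rw [h4, W.coord_sum h1]
  exact h3 j h

theorem cK_mem_K : W.cK ∈ W.K := interior_subset W.cK_mem

theorem c_mem_face (m : Fin 4) : W.c m ∈ W.face m := by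
  obtain ⟨w, h1, h2, h3, h4⟩ := W.c_mem m
  rw [h4, ← Finset.sum_subset (Finset.subset_univ (Finset.univ.erase m))
    (fun i _ hi => by
      have : i = m := by simpa using hi
      rw [this, h2, zero_smul])]
  refine (convex_convexHull ℝ _).sum_mem (fun i hi => (h3 i (Finset.ne_of_mem_erase hi)).le) ?_
    (fun i hi => subset_convexHull ℝ _ ⟨i, Finset.ne_of_mem_erase hi, rfl⟩)
  rw [← h1, ← Finset.add_sum_erase _ _ (Finset.mem_univ m), h2, zero_add]

theorem Q_mem_face {m j : Fin 4} (h : j ≠ m) : W.Q j ∈ W.face m :=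
  subset_convexHull ℝ _ ⟨j, h, rfl⟩

theorem face_subset_K (m : Fin 4) : W.face m ⊆ W.K := convexHull_mono (image_subset_range _ _)

theorem c_mem_K (m : Fin 4) : W.c m ∈ W.K := W.face_subset_K m (W.c_mem_face m)

theorem convex_K : Convex ℝ W.K := convex_convexHull ℝ _

theorem convex_face (m : Fin 4) : Convex ℝ (W.face m) := convex_convexHull ℝ _

theorem subTet_subset_K (t : SubTet) : W.subTet t ⊆ W.K := by
  refine convexHull_min ?_ W.convex_K
  rintro _ (rfl | rfl | rfl | rfl)
  exacts [W.Q_mem _, W.Q_mem _, W.cK_mem_K, W.c_mem_K _]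

theorem triangle_subset_face {m : Fin 4} {e : Edge} (h1 : m ≠ e.1.1) (h2 : m ≠ e.1.2) :
    convexHull ℝ {W.c m, W.Q e.1.1, W.Q e.1.2} ⊆ W.face m := by
  refine convexHull_min ?_ (W.convex_face m)
  rintro _ (rfl | rfl | rfl)
  exacts [W.c_mem_face _, W.Q_mem_face h1.symm, W.Q_mem_face h2.symm]

theorem exists_edge (m : Fin 4) : ∀ j k : Fin 4, j ≠ m → k ≠ m → ∃ e : Edge,
    m ≠ e.1.1 ∧ m ≠ e.1.2 ∧ (j = e.1.1 ∨ j = e.1.2) ∧ (k = e.1.1 ∨ k = e.1.2) := by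
  revert m; decide

/-! ### Propagation of vanishing ordinates -/

/-- On a face, all ordinates of a `C¹` function which is cubic on the three triangles with common
vertex `c_m` are determined by those which involve only vertices of the face. -/
theorem face_trilinear_eq_zero {J : E3 → E3 → E3 → ℝ} (m : Fin 4)
    (hcomm : ∀ x y z, J x y z = J y x z)
    (hsum : ∀ (x y : E3) (w : Fin 4 → ℝ), ∑ i, w i = 1 →
      J x y (∑ i, w i • W.Q i) = ∑ i, w i * J x y (W.Q i))
    (hswap : ∀ e : Edge, m ≠ e.1.1 → m ≠ e.1.2 →
      ∀ x ∈ ({W.c m, W.Q e.1.1, W.Q e.1.2} : Set E3),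
      ∀ y ∈ ({W.c m, W.Q e.1.1, W.Q e.1.2} : Set E3),
      ∀ z ∈ ({W.c m, W.Q e.1.1, W.Q e.1.2} : Set E3), J x y z = J x z y)
    (h0 : ∀ j k l, j ≠ m → k ≠ m → l ≠ m → J (W.Q j) (W.Q k) (W.Q l) = 0)
    {e : Edge} (h1 : m ≠ e.1.1) (h2 : m ≠ e.1.2) :
    ∀ x ∈ ({W.c m, W.Q e.1.1, W.Q e.1.2} : Set E3),
    ∀ y ∈ ({W.c m, W.Q e.1.1, W.Q e.1.2} : Set E3),
    ∀ z ∈ ({W.c m, W.Q e.1.1, W.Q e.1.2} : Set E3), J x y z = 0 := by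
  -- `c_m` is an affine combination of the vertices of the face
  have hc : ∀ x y, (∀ l, l ≠ m → J x y (W.Q l) = 0) → J x y (W.c m) = 0 := by
    intro x y h
    rw [← W.sum_coord_smul (W.c m), hsum _ _ _ (W.sum_coord _)]
    refine Finset.sum_eq_zero fun l _ => ?_
    rcases eq_or_ne l m with rfl | hl
    · rw [W.coord_c_self, zero_mul]
    · rw [h l hl, mul_zero]
  have hs : ∀ j k, j ≠ m → k ≠ m → ∀ x ∈ ({W.c m, W.Q j, W.Q k} : Set E3),
      ∀ y ∈ ({W.c m, W.Q j, W.Q k} : Set E3), ∀ z ∈ ({W.c m, W.Q j, W.Q k} : Set E3),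
      J x y z = J x z y := by
    intro j k hj hk
    obtain ⟨e', he1, he2, hje, hke⟩ := exists_edge m j k hj hk
    have hsub : ({W.c m, W.Q j, W.Q k} : Set E3) ⊆ {W.c m, W.Q e'.1.1, W.Q e'.1.2} := by
      rintro _ (rfl | rfl | rfl)
      · simp
      · rcases hje with h | h <;> simp [h]
      · rcases hke with h | h <;> simp [h]
    intro x hx y hy z hz
    exact hswap e' he1 he2 x (hsub hx) y (hsub hy) z (hsub hz)
  have a1 : ∀ j k, j ≠ m → k ≠ m → J (W.Q j) (W.Q k) (W.c m) = 0 := fun j k hj hk =>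
    hc _ _ fun l hl => h0 j k l hj hk hl
  have a2 : ∀ j k, j ≠ m → k ≠ m → J (W.Q j) (W.c m) (W.Q k) = 0 := fun j k hj hk => by
    rw [hs j k hj hk _ (by simp) _ (by simp) _ (by simp), a1 j k hj hk]
  have a3 : ∀ j k, j ≠ m → k ≠ m → J (W.c m) (W.Q j) (W.Q k) = 0 := fun j k hj hk => by
    rw [hcomm, a2 j k hj hk]
  have a4 : ∀ j, j ≠ m → J (W.c m) (W.Q j) (W.c m) = 0 := fun j hj => hc _ _ fun l hl => a3 j l hj hl
  have a5 : ∀ j, j ≠ m → J (W.Q j) (W.c m) (W.c m) = 0 := fun j hj => by rw [hcomm, a4 j hj]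
  have a6 : ∀ j, j ≠ m → J (W.c m) (W.c m) (W.Q j) = 0 := fun j hj => by
    rw [hs j j hj hj _ (by simp) _ (by simp) _ (by simp), a4 j hj]
  have a7 : J (W.c m) (W.c m) (W.c m) = 0 := hc _ _ a6
  rintro x (rfl | rfl | rfl) y (rfl | rfl | rfl) z (rfl | rfl | rfl) <;>
  first
  | exact a7
  | exact a6 _ (Ne.symm ‹_›)
  | exact a5 _ (Ne.symm ‹_›)
  | exact a4 _ (Ne.symm ‹_›)
  | exact a3 _ _ h1.symm h2.symm
  | exact a3 _ _ h2.symm h1.symm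
  | exact a3 _ _ h1.symm h1.symm
  | exact a3 _ _ h2.symm h2.symm
  | exact a2 _ _ h1.symm h2.symm
  | exact a2 _ _ h2.symm h1.symm
  | exact a2 _ _ h1.symm h1.symm
  | exact a2 _ _ h2.symm h2.symm
  | exact a1 _ _ h1.symm h2.symm
  | exact a1 _ _ h2.symm h1.symm
  | exact a1 _ _ h1.symm h1.symm
  | exact a1 _ _ h2.symm h2.symm
  | exact h0 _ _ _ (by first | exact h1.symm | exact h2.symm)
      (by first | exact h1.symm | exact h2.symm) (by first | exact h1.symm | exact h2.symm)

/-- In the whole tetrahedron, all ordinates of a `C¹` function which is cubic on the twelve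
subtetrahedra are determined by the first derivatives at the vertices and the midpoints of the
edges. -/
theorem trilinear_eq_zero {J : E3 → E3 → E3 → ℝ}
    (hcomm : ∀ x y z, J x y z = J y x z)
    (hsum : ∀ (x y : E3) (w : Fin 4 → ℝ), ∑ i, w i = 1 →
      J x y (∑ i, w i • W.Q i) = ∑ i, w i * J x y (W.Q i))
    (hswap : ∀ (e : Edge) (m : Fin 4), m ≠ e.1.1 → m ≠ e.1.2 →
      ∀ x ∈ ({W.cK, W.c m, W.Q e.1.1, W.Q e.1.2} : Set E3),
      ∀ y ∈ ({W.cK, W.c m, W.Q e.1.1, W.Q e.1.2} : Set E3),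
      ∀ z ∈ ({W.cK, W.c m, W.Q e.1.1, W.Q e.1.2} : Set E3), J x y z = J x z y)
    (h0 : ∀ j k l, J (W.Q j) (W.Q k) (W.Q l) = 0)
    {e : Edge} {m : Fin 4} (h1 : m ≠ e.1.1) (h2 : m ≠ e.1.2) :
    ∀ x ∈ ({W.cK, W.c m, W.Q e.1.1, W.Q e.1.2} : Set E3),
    ∀ y ∈ ({W.cK, W.c m, W.Q e.1.1, W.Q e.1.2} : Set E3),
    ∀ z ∈ ({W.cK, W.c m, W.Q e.1.1, W.Q e.1.2} : Set E3), J x y z = 0 := by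
  have hall : ∀ x y, (∀ l, J x y (W.Q l) = 0) → ∀ z, J x y z = 0 := by
    intro x y h z
    rw [← W.sum_coord_smul z, hsum _ _ _ (W.sum_coord _)]
    exact Finset.sum_eq_zero fun l _ => by rw [h l, mul_zero]
  have hface : ∀ x y, (∀ l, l ≠ m → J x y (W.Q l) = 0) → J x y (W.c m) = 0 := by
    intro x y h
    rw [← W.sum_coord_smul (W.c m), hsum _ _ _ (W.sum_coord _)]
    refine Finset.sum_eq_zero fun l _ => ?_
    rcases eq_or_ne l m with rfl | hl
    · rw [W.coord_c_self, zero_mul]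
    · rw [h l hl, mul_zero]
  have hs : ∀ (m j k : Fin 4), j ≠ m → k ≠ m → ∀ x ∈ ({W.cK, W.c m, W.Q j, W.Q k} : Set E3),
      ∀ y ∈ ({W.cK, W.c m, W.Q j, W.Q k} : Set E3),
      ∀ z ∈ ({W.cK, W.c m, W.Q j, W.Q k} : Set E3), J x y z = J x z y := by
    intro m j k hj hk
    obtain ⟨e', he1, he2, hje, hke⟩ := exists_edge m j k hj hk
    have hsub : ({W.cK, W.c m, W.Q j, W.Q k} : Set E3) ⊆
        {W.cK, W.c m, W.Q e'.1.1, W.Q e'.1.2} := by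
      rintro _ (rfl | rfl | rfl | rfl)
      · simp
      · simp
      · rcases hje with h | h <;> simp [h]
      · rcases hke with h | h <;> simp [h]
    intro x hx y hy z hz
    exact hswap e' m he1 he2 x (hsub hx) y (hsub hy) z (hsub hz)
  have hQQ : ∀ j k z, J (W.Q j) (W.Q k) z = 0 := fun j k => hall _ _ (h0 j k)
  have hKQ : ∀ k z, J W.cK (W.Q k) z = 0 := fun k => hall _ _ fun l => by
    obtain ⟨m, hk, hl⟩ : ∃ m : Fin 4, k ≠ m ∧ l ≠ m := by revert k l; decide
    rw [hcomm, hs m k l hk hl _ (by simp) _ (by simp) _ (by simp), hQQ]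
  have hKc : J W.cK (W.c m) (W.c m) = 0 := hface _ _ fun l hl => by
    rw [hs m l l hl hl _ (by simp) _ (by simp) _ (by simp), hKQ]
  have hKK : ∀ z, J W.cK W.cK z = 0 := hall _ _ fun l => by
    obtain ⟨m, hl⟩ : ∃ m : Fin 4, l ≠ m := by revert l; decide
    rw [hs m l l hl hl _ (by simp) _ (by simp) _ (by simp), hKQ]
  have hsm := hs m e.1.1 e.1.2 h1.symm h2.symm
  -- all ordinates which involve `c_K` vanish
  have hK : ∀ y ∈ ({W.cK, W.c m, W.Q e.1.1, W.Q e.1.2} : Set E3),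
      ∀ z ∈ ({W.cK, W.c m, W.Q e.1.1, W.Q e.1.2} : Set E3), J W.cK y z = 0 := by
    rintro y (rfl | rfl | rfl | rfl) z hz
    · exact hKK z
    · obtain rfl | rfl | rfl | rfl := hz
      · rw [hsm _ (by simp) _ (by simp) _ (by simp), hKK]
      · exact hKc
      · rw [hsm _ (by simp) _ (by simp) _ (by simp), hKQ]
      · rw [hsm _ (by simp) _ (by simp) _ (by simp), hKQ]
    · exact hKQ _ z
    · exact hKQ _ z
  have hF := W.face_trilinear_eq_zero m hcomm hsum
    (fun e he1 he2 x hx y hy z hz => hswap e m he1 he2 x (Or.inr hx) y (Or.inr hy) z (Or.inr hz))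
    (fun j k l _ _ _ => h0 j k l) h1 h2
  intro x hx y hy z hz
  by_cases hx' : x = W.cK
  · rw [hx']; exact hK y hy z hz
  by_cases hy' : y = W.cK
  · rw [hcomm, hy']; exact hK x hx z hz
  by_cases hz' : z = W.cK
  · rw [hsm x hx y hy z hz, hcomm, hz']; exact hK x hx y hy
  exact hF x (hx.resolve_left hx') y (hy.resolve_left hy') z (hz.resolve_left hz')

end Partition

/-! ### Unisolvence on the faces and in the tetrahedron -/

theorem mem_convexHull_range {n : ℕ} {P : Fin n → E3} {y : E3} :
    y ∈ convexHull ℝ (range P) ↔ ∃ w : Fin n → ℝ, (∀ i, 0 ≤ w i) ∧ ∑ i, w i = 1 ∧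
      y = ∑ i, w i • P i := by
  constructor
  · intro h
    rw [convexHull_range_eq_exists_affineCombination] at h
    obtain ⟨s, w, h0, h1, rfl⟩ := h
    refine ⟨fun i => if i ∈ s then w i else 0, fun i => ?_, ?_, ?_⟩
    · dsimp only
      split_ifs with hi
      exacts [h0 i hi, le_rfl]
    · rw [← h1]; simp
    · rw [s.affineCombination_eq_linear_combination _ _ h1]; simp [ite_smul]
  · rintro ⟨w, h0, h1, rfl⟩
    exact (convex_convexHull ℝ _).sum_mem (fun i _ => h0 i) h1
      (fun i _ => subset_convexHull ℝ _ (mem_range_self i))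

theorem isCubicOn_of_eq_polyVal {n : ℕ} {f : E3 → ℝ} {P : Fin n → E3}
    (h : ∃ p : MvPolynomial (Fin 3) ℝ, p.totalDegree ≤ 3 ∧
      ∀ y ∈ convexHull ℝ (range P), f y = polyVal p y) : IsCubicOn f P := by
  obtain ⟨p, hp, hfp⟩ := h
  obtain ⟨c, hc⟩ := exists_ordinates p hp P
  exact ⟨c, fun w h0 h1 => by rw [hfp _ (mem_convexHull_range.2 ⟨w, h0, h1, rfl⟩), hc w h1]⟩

theorem range_three {α : Type*} (a b c : α) : range ![a, b, c] = {a, b, c} := by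
  simp only [Matrix.range_cons, Matrix.range_empty, union_empty, singleton_union]

theorem range_four {α : Type*} (a b c d : α) : range ![a, b, c, d] = {a, b, c, d} := by
  simp only [Matrix.range_cons, Matrix.range_empty, union_empty, singleton_union]

/-- Two derivatives relative to a convex set agree on the vectors pointing into the set. -/
theorem hasFDerivWithinAt_unique_of_convex {f : E3 → ℝ} {S : Set E3} (hS : Convex ℝ S) {x y : E3}
    (hx : x ∈ S) (hy : y ∈ S) {D D' : E3 →L[ℝ] ℝ} (hD : HasFDerivWithinAt f D S x)
    (hD' : HasFDerivWithinAt f D' S x) : D (y - x) = D' (y - x) :=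
  hD.unique_on hD' (mem_tangentConeAt_of_segment_subset (hS.segment_subset hx hy))

namespace Partition

variable (W : Partition)

theorem Q_mem_subset_range {m : Fin 4} {e : Edge} :
    W.Q e.1.1 ∈ range ![W.c m, W.Q e.1.1, W.Q e.1.2] ∧
      W.Q e.1.2 ∈ range ![W.c m, W.Q e.1.1, W.Q e.1.2] := by
  rw [range_three]; simp

theorem polar_Q_eq_zero {f : E3 → ℝ} {D : E3 → E3 →L[ℝ] ℝ} {j k : Fin 4} {Z : E3}
    (hj : jet f D (W.Q j) Z = 0) (hk : jet f D (W.Q k) Z = 0)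
    (he : ∀ e : Edge, (e.1 = (j, k) ∨ e.1 = (k, j)) → jet f D (W.mid e) Z = 0) :
    polar f D (W.Q j) (W.Q k) Z = 0 := by
  rcases lt_trichotomy j k with h | rfl | h
  · have := he ⟨(j, k), h⟩ (Or.inl rfl)
    rw [mid] at this
    rw [polar, this, hj, hk]; norm_num
  · rw [polar_self, hj]
  · have := he ⟨(k, j), h⟩ (Or.inr rfl)
    rw [mid] at this
    rw [polar_comm, polar, this, hj, hk]; norm_num

theorem edgeVec_ne_zero (e : Edge) : W.edgeVec e ≠ 0 := by
  intro h
  exact e.2.ne' (W.affineIndependent.injective (sub_eq_zero.1 h))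

theorem edgeVec_eq (e : Edge) : W.edgeVec e = (2 : ℝ) • (W.Q e.1.2 - W.mid e) := by
  rw [edgeVec, mid]; module

/-- If the jets at both endpoints of an edge vanish along the edge, then so do the value at the
midpoint and the tangential derivative there. -/
theorem jet_mid_eq_zero {f : E3 → ℝ} {D : E3 → E3 →L[ℝ] ℝ} {n : ℕ} {P : Fin n → E3} {S : Set E3}
    (hf : IsCubicOn f P) (hD : ∀ x ∈ S, HasFDerivWithinAt f (D x) S x)
    (hPS : convexHull ℝ (range P) ⊆ S) {e : Edge} (h1 : W.Q e.1.1 ∈ range P)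
    (h2 : W.Q e.1.2 ∈ range P)
    (h11 : jet f D (W.Q e.1.1) (W.Q e.1.1) = 0) (h12 : jet f D (W.Q e.1.1) (W.Q e.1.2) = 0)
    (h21 : jet f D (W.Q e.1.2) (W.Q e.1.1) = 0) (h22 : jet f D (W.Q e.1.2) (W.Q e.1.2) = 0) :
    f (W.mid e) = 0 ∧ D (W.mid e) (W.Q e.1.2 - W.mid e) = 0 := by
  have a1 : jet f D (W.mid e) (W.Q e.1.1) = 0 := by
    rw [mid, hf.jet_mid hD hPS h1 h2, h11, h12, h21]; norm_num
  have a2 : jet f D (W.mid e) (W.Q e.1.2) = 0 := by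
    rw [mid, add_comm, hf.jet_mid hD hPS h2 h1, h22, h12, h21]; norm_num
  have a3 : W.Q e.1.1 - W.mid e = -(W.Q e.1.2 - W.mid e) := by rw [mid]; module
  rw [jet, a3, map_neg] at a1
  rw [jet] at a2
  constructor <;> linarith

/-- A Hsieh-Clough-Tocher function with vanishing data vanishes. -/
theorem hct_eq_zero {m : Fin 4} {f : E3 → ℝ} (hC : ContDiffOn ℝ 1 f (W.face m))
    (hcub : ∀ e : Edge, m ≠ e.1.1 → m ≠ e.1.2 →
      ∃ p : MvPolynomial (Fin 3) ℝ, p.totalDegree ≤ 3 ∧ ∀ y ∈ convexHull ℝ {W.c m, W.Q e.1.1, W.Q e.1.2}, f y = polyVal p y)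
    (hv : ∀ l : Fin 4, l ≠ m → f (W.Q l) = 0 ∧ ∀ s ∈ W.faceDirection m,
      HasDirDerivWithin f (W.face m) (W.Q l) s 0)
    (hmid : ∀ e : Edge, m ≠ e.1.1 → m ≠ e.1.2 → ∀ s ∈ W.faceDirection m,
      inner ℝ s (W.edgeVec e) = (0 : ℝ) → HasDirDerivWithin f (W.face m) (W.mid e) s 0)
    {e : Edge} (h1 : m ≠ e.1.1) (h2 : m ≠ e.1.2) {y : E3}
    (hy : y ∈ convexHull ℝ {W.c m, W.Q e.1.1, W.Q e.1.2}) : f y = 0 := by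
  set D : E3 → E3 →L[ℝ] ℝ := fun x => fderivWithin ℝ f (W.face m) x with hDdef
  have hD : ∀ x ∈ W.face m, HasFDerivWithinAt f (D x) (W.face m) x := fun x hx =>
    (hC.differentiableOn one_ne_zero x hx).hasFDerivWithinAt
  have hdir : ∀ j k, j ≠ m → k ≠ m → W.Q k - W.Q j ∈ W.faceDirection m := fun j k hj hk =>
    vsub_mem_vectorSpan ℝ ⟨k, hk, rfl⟩ ⟨j, hj, rfl⟩
  have hP : ∀ e : Edge, m ≠ e.1.1 → m ≠ e.1.2 → IsCubicOn f ![W.c m, W.Q e.1.1, W.Q e.1.2] ∧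
      convexHull ℝ (range ![W.c m, W.Q e.1.1, W.Q e.1.2]) ⊆ W.face m := by
    intro e he1 he2
    refine ⟨isCubicOn_of_eq_polyVal ?_, ?_⟩
    · rw [range_three]; exact hcub e he1 he2
    · rw [range_three]; exact W.triangle_subset_face he1 he2
  have hjv : ∀ j k, j ≠ m → k ≠ m → jet f D (W.Q j) (W.Q k) = 0 := by
    intro j k hj hk
    obtain ⟨D', hD', h0⟩ := (hv j hj).2 _ (hdir j k hj hk)
    rw [jet, (hv j hj).1, hasFDerivWithinAt_unique_of_convex (W.convex_face m) (W.Q_mem_face hj)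
      (W.Q_mem_face hk) (hD _ (W.Q_mem_face hj)) hD', h0]
    norm_num
  have hmem : ∀ e : Edge, m ≠ e.1.1 → m ≠ e.1.2 → W.mid e ∈ W.face m := by
    intro e he1 he2
    have := W.convex_face m (W.Q_mem_face he1.symm) (W.Q_mem_face he2.symm)
      (a := (1 / 2 : ℝ)) (b := (1 / 2 : ℝ)) (by norm_num) (by norm_num) (by norm_num)
    rwa [← smul_add] at this
  have hjm : ∀ (e : Edge) (l : Fin 4), m ≠ e.1.1 → m ≠ e.1.2 → l ≠ m →
      jet f D (W.mid e) (W.Q l) = 0 := by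
    intro e l he1 he2 hl
    obtain ⟨hcu, hsub⟩ := hP e he1 he2
    obtain ⟨b1, b2⟩ := W.jet_mid_eq_zero hcu hD hsub W.Q_mem_subset_range.1
      W.Q_mem_subset_range.2 (hjv _ _ he1.symm he1.symm) (hjv _ _ he1.symm he2.symm)
      (hjv _ _ he2.symm he1.symm) (hjv _ _ he2.symm he2.symm)
    -- the component of `Q_l - M` perpendicular to the edge
    set a : ℝ := inner ℝ (W.Q l - W.mid e) (W.edgeVec e) / inner ℝ (W.edgeVec e) (W.edgeVec e)
      with ha
    have hne : inner ℝ (W.edgeVec e) (W.edgeVec e) ≠ (0 : ℝ) :=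
      inner_self_ne_zero.2 (W.edgeVec_ne_zero e)
    have hs : W.Q l - W.mid e - a • W.edgeVec e ∈ W.faceDirection m := by
      have h3 : W.Q l - W.mid e = (1 / 2 : ℝ) • (W.Q l - W.Q e.1.1) +
          (1 / 2 : ℝ) • (W.Q l - W.Q e.1.2) := by rw [mid]; module
      rw [h3]
      exact sub_mem (add_mem (Submodule.smul_mem _ _ (hdir _ _ he1.symm hl))
        (Submodule.smul_mem _ _ (hdir _ _ he2.symm hl)))
        (Submodule.smul_mem _ _ (hdir _ _ he1.symm he2.symm))
    obtain ⟨D', hD', h0⟩ := hmid e he1 he2 _ hs (by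
      rw [inner_sub_left, inner_smul_left, ha]
      simp only [conj_trivial]
      field_simp
      ring)
    have hM := hmem e he1 he2
    rw [jet, b1, hasFDerivWithinAt_unique_of_convex (W.convex_face m) hM (W.Q_mem_face hl)
      (hD _ hM) hD']
    rw [hasFDerivWithinAt_unique_of_convex (W.convex_face m) hM (W.Q_mem_face he2.symm)
      (hD _ hM) hD'] at b2
    rw [map_sub D', map_smul, W.edgeVec_eq, map_smul, b2, smul_zero, smul_zero, sub_zero] at h0
    rw [h0]; norm_num
  have key := W.face_trilinear_eq_zero m (J := polar f D) polar_comm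
    (fun x y w hw => polar_sum x y W.Q hw)
    (fun e he1 he2 x hx y hy z hz => (hP e he1 he2).1.polar_swap hD (hP e he1 he2).2
      (by rwa [range_three]) (by rwa [range_three]) (by rwa [range_three]))
    (fun j k l hj hk hl => W.polar_Q_eq_zero (hjv j l hj hl) (hjv k l hk hl) (by
      rintro ⟨e, he⟩ (rfl | rfl)
      · exact hjm _ l hj.symm hk.symm hl
      · exact hjm _ l hk.symm hj.symm hl)) h1 h2
  rw [← range_three] at hy key
  obtain ⟨w, h0, hw1, rfl⟩ := mem_convexHull_range.1 hy
  exact (hP e h1 h2).1.eq_zero hD (hP e h1 h2).2 key h0 hw1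

theorem dof_dofNumber {W : Partition} (ν : W.EdgeNormals) (f : W.space) (d : DofLabel) :
    dof ν (dofNumber d) f = labelledDof ν d ⟨f.1, f.2.1⟩ := by
  rw [dof, Equiv.symm_apply_apply]; rfl

theorem subTet_eq (t : SubTet) : W.subTet t =
    convexHull ℝ (range ![W.cK, W.c t.1.2, W.Q t.1.1.1.1, W.Q t.1.1.1.2]) := by
  rw [range_four, subTet]
  congr 1
  ext x
  simp only [mem_insert_iff, mem_singleton_iff]
  tauto

/-- A function of the finite element space vanishes if all its degrees of freedom do. -/
theorem eq_zero_of_dof_eq_zero {W : Partition} (ν : W.EdgeNormals) (f : W.space)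
    (h : ∀ μ, dof ν μ f = 0) (t : SubTet) {y : E3} (hy : y ∈ W.subTet t) : ext f.1 y = 0 := by
  have hl : ∀ d, labelledDof ν d ⟨f.1, f.2.1⟩ = 0 := fun d => by rw [← dof_dofNumber, h]
  set D : E3 → E3 →L[ℝ] ℝ := fun x => fderivWithin ℝ (ext f.1) W.K x with hDdef
  have hC : ContDiffOn ℝ 1 (ext f.1) W.K := f.2.1
  have hD : ∀ x ∈ W.K, HasFDerivWithinAt (ext f.1) (D x) W.K x := fun x hx =>
    (hC.differentiableOn one_ne_zero x hx).hasFDerivWithinAt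
  have hP : ∀ t : SubTet,
      IsCubicOn (ext f.1) ![W.cK, W.c t.1.2, W.Q t.1.1.1.1, W.Q t.1.1.1.2] ∧
      convexHull ℝ (range ![W.cK, W.c t.1.2, W.Q t.1.1.1.1, W.Q t.1.1.1.2]) ⊆ W.K := by
    intro t
    rw [← W.subTet_eq]
    refine ⟨isCubicOn_of_eq_polyVal ?_, W.subTet_subset_K t⟩
    rw [← W.subTet_eq]
    obtain ⟨p, hp, hfp⟩ := f.2.2 _ (mem_range_self t)
    exact ⟨p, hp, fun y hy => (ext_apply f.1 ⟨y, W.subTet_subset_K t hy⟩).trans (hfp _ hy)⟩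
  have hjv : ∀ j Z, jet (ext f.1) D (W.Q j) Z = 0 := by
    intro j Z
    have b1 : ext f.1 (W.Q j) = 0 := (ext_apply f.1 ⟨W.Q j, W.Q_mem j⟩).trans (hl (.inl j))
    have b2 : D (W.Q j) = 0 := by
      refine ContinuousLinearMap.coe_injective
        ((EuclideanSpace.basisFun (Fin 3) ℝ).toBasis.ext fun l => ?_)
      have h1 : D (W.Q j) (EuclideanSpace.single l 1) = 0 := hl (.inr (.inl (l, j)))
      simpa using h1
    rw [jet, b1, b2]; simp
  have hjm : ∀ (e : Edge) (Z : E3), jet (ext f.1) D (W.mid e) Z = 0 := by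
    intro e Z
    obtain ⟨m, hm1, hm2⟩ : ∃ m : Fin 4, m ≠ e.1.1 ∧ m ≠ e.1.2 := by revert e; decide
    obtain ⟨hcu, hsub⟩ := hP ⟨(e, m), hm1, hm2⟩
    obtain ⟨b1, b2⟩ := W.jet_mid_eq_zero (e := e) hcu hD hsub (by rw [range_four]; simp)
      (by rw [range_four]; simp) (hjv _ _) (hjv _ _) (hjv _ _) (hjv _ _)
    have b3 : Submodule.span ℝ {W.edgeVec e, ν.vec e 0, ν.vec e 1} ≤
        LinearMap.ker (D (W.mid e)).toLinearMap := by
      rw [Submodule.span_le]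
      rintro _ (rfl | rfl | rfl)
      · change D (W.mid e) (W.edgeVec e) = 0
        rw [W.edgeVec_eq, map_smul, b2, smul_zero]
      · exact hl (.inr (.inr (e, 0)))
      · exact hl (.inr (.inr (e, 1)))
    rw [ν.span_eq_top] at b3
    have b4 : D (W.mid e) (Z - W.mid e) = 0 := b3 (Submodule.mem_top)
    rw [jet, b1, b4]; norm_num
  have key := W.trilinear_eq_zero (J := polar (ext f.1) D) polar_comm
    (fun x y w hw => polar_sum x y W.Q hw)
    (fun e m he1 he2 x hx y hy z hz => (hP ⟨(e, m), he1, he2⟩).1.polar_swap hD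
      (hP ⟨(e, m), he1, he2⟩).2
      (by rwa [range_four]) (by rwa [range_four]) (by rwa [range_four]))
    (fun j k l => W.polar_Q_eq_zero (hjv j _) (hjv k _) fun e _ => hjm e _) t.2.1 t.2.2
  rw [W.subTet_eq] at hy
  rw [← range_four] at key
  obtain ⟨w, h0, hw1, rfl⟩ := mem_convexHull_range.1 hy
  exact (hP t).1.eq_zero hD (hP t).2 key h0 hw1

end Partition

/-! ### Gluing differentiable pieces -/

theorem hasFDerivWithinAt_of_finite_cover {ι : Type*} [Finite ι] {f : E3 → ℝ} {D : E3 →L[ℝ] ℝ}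
    {K : Set E3} {T : ι → Set E3} {x : E3} (hcov : K ⊆ ⋃ i, T i)
    (h : ∀ i, HasFDerivWithinAt f D (T i) x) : HasFDerivWithinAt f D K x := by
  refine HasFDerivWithinAt.mono ?_ hcov
  have hfin : ∀ s : Set ι, s.Finite → HasFDerivWithinAt f D (⋃ i ∈ s, T i) x := by
    intro s hs
    induction s, hs using Set.Finite.induction_on with
    | empty =>
      refine HasFDerivWithinAt.of_notMem_closure ?_
      simp
    | insert _ _ ih =>
      rw [biUnion_insert]
      exact (h _).union ih
  simpa using hfin univ finite_univ

/-- Functions `p_i` on finitely many closed sets `T_i` with equal values and derivatives on the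
overlaps form a `C¹` function on the union. -/
theorem exists_glue {ι : Type*} [Finite ι] {K : Set E3} (hK : UniqueDiffOn ℝ K) {T : ι → Set E3}
    (hT : ∀ i, IsClosed (T i)) (hcov : K = ⋃ i, T i) {p : ι → E3 → ℝ}
    (hp : ∀ i, ContDiff ℝ 1 (p i))
    (hmatch : ∀ i j x, x ∈ T i → x ∈ T j →
      p i x = p j x ∧ fderiv ℝ (p i) x = fderiv ℝ (p j) x) :
    ∃ f : K → ℝ, f ∈ C1 K ∧ ∀ i, ∀ x ∈ T i, ext f x = p i x ∧
      HasFDerivWithinAt (ext f) (fderiv ℝ (p i) x) K x := by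
  have hex : ∀ x : K, ∃ i, x.1 ∈ T i := fun x => mem_iUnion.1 (hcov.subset x.2)
  choose ix hix using hex
  classical
  set f : K → ℝ := fun x => p (ix x) x with hf
  set D : E3 → E3 →L[ℝ] ℝ := fun x => if h : x ∈ K then fderiv ℝ (p (ix ⟨x, h⟩)) x else 0 with hDdef
  have hTK : ∀ i, T i ⊆ K := fun i => by rw [hcov]; exact subset_iUnion T i
  have hfT : ∀ i, ∀ x ∈ T i, ext f x = p i x := fun i x hx => by
    rw [show ext f x = f ⟨x, hTK i hx⟩ from ext_apply f ⟨x, hTK i hx⟩]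
    exact (hmatch _ _ _ (hix ⟨x, hTK i hx⟩) hx).1
  have hDT : ∀ i, ∀ x ∈ T i, D x = fderiv ℝ (p i) x := fun i x hx => by
    simp only [hDdef, dif_pos (hTK i hx)]
    exact (hmatch _ _ _ (hix ⟨x, hTK i hx⟩) hx).2
  have hder : ∀ x, HasFDerivWithinAt (ext f) (D x) K x := by
    intro x
    refine hasFDerivWithinAt_of_finite_cover hcov.subset fun i => ?_
    by_cases hx : x ∈ T i
    · rw [hDT i x hx]
      exact ((hp i).differentiable one_ne_zero x).hasFDerivAt.hasFDerivWithinAt.congr (hfT i)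
        (hfT i x hx)
    · exact HasFDerivWithinAt.of_notMem_closure (by rwa [(hT i).closure_eq])
  refine ⟨f, ?_, fun i x hx => ⟨hfT i x hx, hDT i x hx ▸ hder x⟩⟩
  change ContDiffOn ℝ 1 (ext f) K
  rw [← zero_add 1, contDiffOn_succ_iff_hasFDerivWithinAt_of_uniqueDiffOn hK]
  refine ⟨by simp, D, contDiffOn_zero.2 ?_, fun x _ => hder x⟩
  rw [hcov]
  exact (locallyFinite_of_finite T).continuousOn_iUnion hT fun i =>
    ((hp i).continuous_fderiv one_ne_zero).continuousOn.congr (hDT i)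

/-! ### Polynomial functions -/

/-- Polynomial functions on `ℝ³` of degree at most `k`. -/
def IsPoly (k : ℕ) (F : E3 → ℝ) : Prop :=
  ∃ p : MvPolynomial (Fin 3) ℝ, p.totalDegree ≤ k ∧ ∀ x, F x = polyVal p x

namespace IsPoly

variable {k l : ℕ} {F G : E3 → ℝ}

theorem const (a : ℝ) : IsPoly k fun _ => a :=
  ⟨MvPolynomial.C a, by simp, by simp [polyVal]⟩

theorem add (hF : IsPoly k F) (hG : IsPoly k G) : IsPoly k fun x => F x + G x := by
  obtain ⟨p, hp, hFp⟩ := hF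
  obtain ⟨q, hq, hGq⟩ := hG
  exact ⟨p + q, (MvPolynomial.totalDegree_add p q).trans (max_le hp hq), fun x => by
    simp only [hFp, hGq, polyVal, map_add]⟩

theorem mul (hF : IsPoly k F) (hG : IsPoly l G) : IsPoly (k + l) fun x => F x * G x := by
  obtain ⟨p, hp, hFp⟩ := hF
  obtain ⟨q, hq, hGq⟩ := hG
  exact ⟨p * q, (MvPolynomial.totalDegree_mul p q).trans (add_le_add hp hq), fun x => by
    simp only [hFp, hGq, polyVal, map_mul]⟩

theorem sum {ι : Type*} {s : Finset ι} {F : ι → E3 → ℝ} (hF : ∀ i ∈ s, IsPoly k (F i)) :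
    IsPoly k fun x => ∑ i ∈ s, F i x := by
  classical
  induction s using Finset.induction_on with
  | empty => simpa using const 0
  | insert a s ha ih =>
    simp only [Finset.sum_insert ha]
    exact (hF a (Finset.mem_insert_self a s)).add
      (ih fun i hi => hF i (Finset.mem_insert_of_mem hi))

theorem coordinate (i : Fin 3) : IsPoly 1 fun x => x i :=
  ⟨MvPolynomial.X i, by simp, by simp [polyVal]⟩

theorem affine (A : E3 →ᵃ[ℝ] ℝ) : IsPoly 1 A := by
  have h : (A : E3 → ℝ) = fun x =>
      ∑ i, x i * A.linear (EuclideanSpace.single i 1) + A 0 := by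
    funext x
    have h1 : A x = A.linear x + A 0 := by
      simpa using A.map_vadd 0 x
    have h2 : x = ∑ i, x i • EuclideanSpace.single i (1 : ℝ) := by
      simpa using ((EuclideanSpace.basisFun (Fin 3) ℝ).sum_repr x).symm
    rw [h1]
    conv_lhs => rw [h2]
    simp
  rw [h]
  exact (sum fun i _ => (coordinate i).mul (const (k := 0) _)).add (const _)

theorem contDiff (hF : IsPoly k F) : ContDiff ℝ 1 F := by
  obtain ⟨p, -, hFp⟩ := hF
  rw [funext hFp]
  clear hFp
  unfold polyVal
  induction p using MvPolynomial.induction_on with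
  | C a => simpa using contDiff_const
  | add p q hp hq => simpa using hp.add hq
  | mul_X p i hp =>
    simp only [map_mul, MvPolynomial.eval_X]
    refine hp.mul ?_
    exact (EuclideanSpace.proj i : E3 →L[ℝ] ℝ).contDiff

end IsPoly

namespace Partition

variable (W : Partition)

theorem isClosed_subTet (t : SubTet) : IsClosed (W.subTet t) :=
  (Set.Finite.isCompact_convexHull ℝ (by simp)).isClosed

/-! ### Location of a point in the Worsey-Farin partition -/

/-- The index different from those of the edge and of the face of a subtetrahedron; the four indices
add up to `6`, which is `2` in `Fin 4`. -/
def opp (t : SubTet) : Fin 4 := 2 - (t.1.2 + t.1.1.1.1 + t.1.1.1.2)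

theorem opp_spec : ∀ t : SubTet, opp t ≠ t.1.2 ∧ opp t ≠ t.1.1.1.1 ∧ opp t ≠ t.1.1.1.2 := by
  decide

theorem index_cases : ∀ (t : SubTet) (l : Fin 4),
    l = t.1.2 ∨ l = opp t ∨ l = t.1.1.1.1 ∨ l = t.1.1.1.2 := by
  decide

theorem exists_subTet : ∀ m i : Fin 4, i ≠ m → ∃ t : SubTet, t.1.2 = m ∧ opp t = i := by
  decide

/-- The barycentric coordinates of a point. -/
def bar (x : E3) : Fin 4 → ℝ := fun j => W.basis.coord j x

/-- The differences of barycentric coordinates belonging to a vector. -/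
def barVec (v : E3) : Fin 4 → ℝ := fun j => (W.basis.coord j).linear v

theorem bar_add_smul (x v : E3) (s : ℝ) : W.bar (x + s • v) = W.bar x + s • W.barVec v := by
  funext j
  have := (W.basis.coord j).map_vadd x (s • v)
  simp only [vadd_eq_add, map_smul, smul_eq_mul] at this
  rw [add_comm x]
  simp only [bar, barVec, Pi.add_apply, Pi.smul_apply, smul_eq_mul]
  rw [this, add_comm]

theorem barVec_sub (x y : E3) : W.barVec (x - y) = W.bar x - W.bar y := by
  have := W.bar_add_smul y (x - y) 1
  rw [one_smul, one_smul, add_sub_cancel] at this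
  rw [this, add_sub_cancel_left]

theorem sum_barVec_smul (v : E3) : ∑ j, W.barVec v j • W.Q j = v := by
  have h := W.barVec_sub v 0
  rw [sub_zero] at h
  rw [h]
  simp only [bar, Pi.sub_apply, sub_smul, Finset.sum_sub_distrib, sum_coord_smul, sub_zero]

theorem sum_barVec (v : E3) : ∑ j, W.barVec v j = 0 := by
  have h := W.barVec_sub v 0
  rw [sub_zero] at h
  rw [h]
  simp only [bar, Pi.sub_apply, Finset.sum_sub_distrib, sum_coord, sub_self]

theorem bar_sum {n : ℕ} (P : Fin n → E3) {w : Fin n → ℝ} (hw : ∑ i, w i = 1) :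
    W.bar (∑ i, w i • P i) = ∑ i, w i • W.bar (P i) := by
  funext j
  simp only [bar, Finset.sum_apply, Pi.smul_apply, smul_eq_mul]
  rw [← Finset.univ.affineCombination_eq_linear_combination _ _ hw, Finset.map_affineCombination _ _ _ hw,
    Finset.univ.affineCombination_eq_linear_combination _ _ hw]
  simp

theorem bar_Q (j : Fin 4) : W.bar (W.Q j) = Pi.single j 1 := by
  classical
  funext i
  rw [bar, ← W.basis_coe, W.basis.coord_apply, Pi.single_apply]

/-- In barycentric coordinates, a subtetrahedron consists of the points `τ c_K + ρ c_m + e`, where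
`e` is a nonnegative combination of the two remaining vertices. -/
theorem bar_of_mem_subTet {t : SubTet} {x : E3} (hx : x ∈ W.subTet t) :
    ∃ (τ ρ : ℝ) (e : Fin 4 → ℝ), 0 ≤ τ ∧ 0 ≤ ρ ∧ (∀ l, 0 ≤ e l) ∧ e t.1.2 = 0 ∧ e (opp t) = 0 ∧
      W.bar x = τ • W.bar W.cK + (ρ • W.bar (W.c t.1.2) + e) := by
  rw [subTet_eq, mem_convexHull_range] at hx
  obtain ⟨w, h0, h1, rfl⟩ := hx
  refine ⟨w 0, w 1, w 2 • Pi.single t.1.1.1.1 1 + w 3 • Pi.single t.1.1.1.2 1, h0 0, h0 1,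
    fun l => ?_, ?_, ?_, ?_⟩
  · exact add_nonneg (mul_nonneg (h0 2) (single_nonneg _ _)) (mul_nonneg (h0 3) (single_nonneg _ _))
  · simp [Pi.single_eq_of_ne t.2.1, Pi.single_eq_of_ne t.2.2]
  · simp [Pi.single_eq_of_ne (opp_spec t).2.1, Pi.single_eq_of_ne (opp_spec t).2.2]
  · rw [W.bar_sum _ h1, Fin.sum_univ_four]
    simp only [Matrix.cons_val, bar_Q]
    abel

/-- The subtetrahedra cover `K`: the index `m` of the face minimizes `λ_m / κ_m`, where `λ` and `κ`
are the barycentric coordinates of the point and of `c_K`, and the index opposite to the edge is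
found in the same way within the face. -/
theorem K_eq_iUnion : W.K = ⋃ t, W.subTet t := by
  refine Subset.antisymm (fun x hx => ?_) (iUnion_subset W.subTet_subset_K)
  rw [mem_K_iff] at hx
  set κ : Fin 4 → ℝ := W.bar W.cK with hκ
  have hκpos : ∀ j, 0 < κ j := W.coord_cK_pos
  obtain ⟨m, hm⟩ := Finite.exists_min fun j => W.bar x j / κ j
  set y : Fin 4 → ℝ := W.bar x - (W.bar x m / κ m) • κ with hy
  have hy0 : ∀ j, 0 ≤ y j := fun j => by
    have := hm j
    rw [le_div_iff₀ (hκpos j)] at this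
    simpa [hy] using this
  have hym : y m = 0 := by
    have := (hκpos m).ne'
    simp only [hy, Pi.sub_apply, Pi.smul_apply, smul_eq_mul]
    field_simp
    ring
  set c : Fin 4 → ℝ := W.bar (W.c m) with hc
  have hcpos : ∀ j, j ≠ m → 0 < c j := fun j hj => W.coord_c_pos hj
  have hcm : c m = 0 := W.coord_c_self m
  obtain ⟨i, him, hi⟩ := Finset.exists_min_image (Finset.univ.erase m) (fun j => y j / c j)
    ⟨m + 1, (by decide : ∀ m : Fin 4, m + 1 ∈ Finset.univ.erase m) m⟩
  rw [Finset.mem_erase] at him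
  set e : Fin 4 → ℝ := y - (y i / c i) • c with he
  have he0 : ∀ j, 0 ≤ e j := fun j => by
    rcases eq_or_ne j m with rfl | hj
    · simp [he, hym, hcm]
    · have := hi j (by simp [hj])
      rw [le_div_iff₀ (hcpos j hj)] at this
      simpa [he] using this
  have hem : e m = 0 := by simp [he, hym, hcm]
  have hei : e i = 0 := by
    have := (hcpos i him.1).ne'
    simp only [he, Pi.sub_apply, Pi.smul_apply, smul_eq_mul]
    field_simp
    ring
  obtain ⟨t, htm, hti⟩ := exists_subTet m i him.1
  have hjk : t.1.1.1.1 ≠ t.1.1.1.2 := t.1.1.2.ne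
  have hrest : ∀ l, l ≠ t.1.1.1.1 ∧ l ≠ t.1.1.1.2 → e l = 0 := by
    rintro l ⟨h1, h2⟩
    rcases index_cases t l with h | h | h | h
    · rw [h, htm, hem]
    · rw [h, hti, hei]
    · exact absurd h h1
    · exact absurd h h2
  have hx1 : ∀ j, W.bar x j = (W.bar x m / κ m) * κ j + ((y i / c i) * c j + e j) := by
    intro j; simp [he, hy]
  refine mem_iUnion.2 ⟨t, ?_⟩
  rw [subTet_eq, mem_convexHull_range]
  refine ⟨![W.bar x m / κ m, y i / c i, e t.1.1.1.1, e t.1.1.1.2], ?_, ?_, ?_⟩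
  · intro l
    fin_cases l
    exacts [div_nonneg (hx m) (hκpos m).le, div_nonneg (hy0 i) (hcpos i him.1).le, he0 _, he0 _]
  · have h1 := W.sum_coord x
    have h2 : ∑ j, κ j = 1 := W.sum_coord W.cK
    have h3 : ∑ j, c j = 1 := W.sum_coord (W.c m)
    have h4 : ∑ j, W.bar x j = 1 := h1
    rw [Finset.sum_congr rfl fun j _ => hx1 j] at h4
    simp only [Finset.sum_add_distrib, ← Finset.mul_sum, h2, h3] at h4
    rw [Fintype.sum_eq_add _ _ hjk hrest] at h4
    rw [Fin.sum_univ_four]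
    simp only [Matrix.cons_val]
    linarith
  · have h1 := (W.sum_coord_smul x).symm
    have h2 : ∑ j, κ j • W.Q j = W.cK := W.sum_coord_smul W.cK
    have h3 : ∑ j, c j • W.Q j = W.c m := W.sum_coord_smul (W.c m)
    have h4 : x = ∑ j, W.bar x j • W.Q j := h1
    rw [Finset.sum_congr rfl fun j _ => by rw [hx1 j]] at h4
    simp only [Finset.sum_add_distrib, add_smul, mul_smul, ← Finset.smul_sum, h2, h3] at h4
    rw [Fintype.sum_eq_add _ _ hjk (fun l hl => by rw [hrest l hl, zero_smul])] at h4
    rw [Fin.sum_univ_four]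
    simp only [Matrix.cons_val, htm]
    rw [← add_assoc] at h4
    rw [← add_assoc] at h4
    exact h4

/-- On the intersection of two subtetrahedra, the decompositions of `bar_of_mem_subTet` agree. -/
theorem decomposition_unique {t t' : SubTet} {τ ρ τ' ρ' : ℝ} {e e' : Fin 4 → ℝ}
    (hρ : 0 ≤ ρ) (he : ∀ l, 0 ≤ e l) (hem : e t.1.2 = 0) (hei : e (opp t) = 0)
    (hρ' : 0 ≤ ρ') (he' : ∀ l, 0 ≤ e' l) (hem' : e' t'.1.2 = 0) (hei' : e' (opp t') = 0)
    (h : τ • W.bar W.cK + (ρ • W.bar (W.c t.1.2) + e) =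
      τ' • W.bar W.cK + (ρ' • W.bar (W.c t'.1.2) + e')) :
    τ = τ' ∧ e = e' ∧ (t.1.2 = t'.1.2 ∧ ρ = ρ' ∨ ρ = 0 ∧ ρ' = 0) := by
  have hK := W.coord_cK_pos
  have hc0 : ∀ m j, 0 ≤ W.bar (W.c m) j := fun m j => by
    rcases eq_or_ne j m with rfl | hj
    · exact (W.coord_c_self j).ge
    · exact (W.coord_c_pos hj).le
  have hτ : ∀ {t t' : SubTet} {τ ρ τ' ρ' : ℝ} {e e' : Fin 4 → ℝ}, e t.1.2 = 0 → 0 ≤ ρ' →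
      (∀ l, 0 ≤ e' l) → τ • W.bar W.cK + (ρ • W.bar (W.c t.1.2) + e) =
        τ' • W.bar W.cK + (ρ' • W.bar (W.c t'.1.2) + e') → τ' ≤ τ := by
    intro t t' τ ρ τ' ρ' e e' hem hρ' he' h
    have h1 := congrFun h t.1.2
    have h2 : W.bar (W.c t.1.2) t.1.2 = 0 := W.coord_c_self _
    simp only [Pi.add_apply, Pi.smul_apply, smul_eq_mul, hem, h2, mul_zero, add_zero] at h1
    have h3 : τ' * W.bar W.cK t.1.2 ≤ τ * W.bar W.cK t.1.2 := by
      rw [h1]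
      have := mul_nonneg hρ' (hc0 t'.1.2 t.1.2)
      linarith [he' t.1.2]
    exact le_of_mul_le_mul_right h3 (hK t.1.2)
  have hττ : τ = τ' := le_antisymm (hτ hem' hρ he h.symm) (hτ hem hρ' he' h)
  subst hττ
  have hy := add_left_cancel h
  refine ⟨rfl, ?_⟩
  by_cases hm : t.1.2 = t'.1.2
  · rw [← hm] at hy
    have hle : ∀ {i : Fin 4} {ρ ρ' : ℝ} {e e' : Fin 4 → ℝ}, i ≠ t.1.2 → e i = 0 →
        (∀ l, 0 ≤ e' l) →
        ρ • W.bar (W.c t.1.2) + e = ρ' • W.bar (W.c t.1.2) + e' → ρ' ≤ ρ := by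
      intro i ρ ρ' e e' hi hei he' h
      have h1 := congrFun h i
      simp only [Pi.add_apply, Pi.smul_apply, smul_eq_mul, hei, add_zero] at h1
      have h3 : ρ' * W.bar (W.c t.1.2) i ≤ ρ * W.bar (W.c t.1.2) i := by
        rw [h1]; linarith [he' i]
      exact le_of_mul_le_mul_right h3 (W.coord_c_pos hi)
    have hρρ : ρ = ρ' := le_antisymm
      (hle (hm ▸ (opp_spec t').1) hei' he hy.symm) (hle (opp_spec t).1 hei he' hy)
    subst hρρ
    exact ⟨add_left_cancel hy, Or.inl ⟨hm, rfl⟩⟩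
  · have hz : ∀ {m m' : Fin 4} {ρ ρ' : ℝ} {e e' : Fin 4 → ℝ}, m ≠ m' → 0 ≤ ρ → (∀ l, 0 ≤ e l) →
        e' m' = 0 → ρ • W.bar (W.c m) + e = ρ' • W.bar (W.c m') + e' → ρ = 0 := by
      intro m m' ρ ρ' e e' hm hρ he hem' h
      have h1 := congrFun h m'
      have h2 : W.bar (W.c m') m' = 0 := W.coord_c_self _
      have h3 : 0 < W.bar (W.c m) m' := W.coord_c_pos (Ne.symm hm)
      simp only [Pi.add_apply, Pi.smul_apply, smul_eq_mul, hem', h2, mul_zero, add_zero] at h1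
      have h4 : ρ * W.bar (W.c m) m' ≤ 0 := by linarith [he m']
      exact le_antisymm (nonpos_of_mul_nonpos_left h4 h3) hρ
    have h1 := hz hm hρ he hem' hy
    have h2 := hz (Ne.symm hm) hρ' he' hem hy.symm
    refine ⟨?_, Or.inr ⟨h1, h2⟩⟩
    simpa [h1, h2] using hy

end Partition

/-! ### The piecewise cubic function with prescribed first-order data -/

/-- The trilinear form on `ℝ⁴` with coefficients `S`. -/
def triForm (S : Fin 4 → Fin 4 → Fin 4 → ℝ) :
    (Fin 4 → ℝ) →ₗ[ℝ] (Fin 4 → ℝ) →ₗ[ℝ] (Fin 4 → ℝ) →ₗ[ℝ] ℝ :=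
  ∑ j, (LinearMap.proj j : (Fin 4 → ℝ) →ₗ[ℝ] ℝ).smulRight
    (∑ k, (LinearMap.proj k : (Fin 4 → ℝ) →ₗ[ℝ] ℝ).smulRight
      (∑ l, S j k l • (LinearMap.proj l : (Fin 4 → ℝ) →ₗ[ℝ] ℝ)))

section Form

variable {S : Fin 4 → Fin 4 → Fin 4 → ℝ}

theorem triForm_apply (x y z : Fin 4 → ℝ) :
    triForm S x y z = ∑ j, x j * ∑ k, y k * ∑ l, S j k l * z l := by
  simp [triForm, LinearMap.sum_apply]

theorem triForm_single (j k l : Fin 4) :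
    triForm S (Pi.single j 1) (Pi.single k 1) (Pi.single l 1) = S j k l := by
  simp [triForm_apply, Pi.single_apply]

theorem triForm_comm (hS : ∀ j k l, S j k l = S k j l) (x y : Fin 4 → ℝ) :
    triForm S x y = triForm S y x := by
  ext l
  simp only [LinearMap.coe_comp, Function.comp_apply, triForm_apply, Finset.mul_sum]
  rw [Finset.sum_comm]
  refine Finset.sum_congr rfl fun j _ => Finset.sum_congr rfl fun k _ =>
    Finset.sum_congr rfl fun l _ => ?_
  rw [hS k j l]; ring

theorem isPoly_triForm {a b c : ℕ} {u v w : E3 → Fin 4 → ℝ} (hu : ∀ j, IsPoly a fun x => u x j)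
    (hv : ∀ j, IsPoly b fun x => v x j) (hw : ∀ j, IsPoly c fun x => w x j) :
    IsPoly (a + (b + c)) fun x => triForm S (u x) (v x) (w x) := by
  simp only [triForm_apply]
  refine IsPoly.sum fun j _ => (hu j).mul (IsPoly.sum fun k _ => (hv k).mul (IsPoly.sum fun l _ => ?_))
  simpa using (IsPoly.const (k := 0) (S j k l)).mul (hw l)

/-- For vectors supported on two indices, the trilinear form is symmetric. -/
theorem triForm_edge (hH : ∀ j k, S j k j = S j j k) {j k : Fin 4}
    (hjk : j ≠ k) {e e' : Fin 4 → ℝ} (he : ∀ l, l ≠ j ∧ l ≠ k → e l = 0)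
    (he' : ∀ l, l ≠ j ∧ l ≠ k → e' l = 0) :
    triForm S e e' e = triForm S e e e' := by
  have h1 : ∀ e : Fin 4 → ℝ, (∀ l, l ≠ j ∧ l ≠ k → e l = 0) →
      e = e j • Pi.single j 1 + e k • Pi.single k 1 := by
    intro e he
    funext l
    by_cases hj : l = j
    · subst hj; simp [Pi.single_eq_of_ne hjk]
    by_cases hk : l = k
    · subst hk; simp [Pi.single_eq_of_ne hj]
    · simp [he l ⟨hj, hk⟩, Pi.single_eq_of_ne hj, Pi.single_eq_of_ne hk]
  rw [h1 e he, h1 e' he']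
  simp only [map_add, map_smul, LinearMap.add_apply, LinearMap.smul_apply, smul_eq_mul,
    triForm_single]
  linear_combination (e j ^ 2 * e' k - e j * e k * e' j) * (hH j k) +
    (e k ^ 2 * e' j - e j * e k * e' k) * (hH k j)

/-- The polar form of the cubic form `B(x, x, x - y) + B(x, y, x - y) + B(y, y, x - y)`, in which
`x - y` is the part of `x` along a fixed vector. For a symmetric `B`, the cubic form is
`B(x, x, x) - B(y, y, y)`. -/
def coneForm (B : (Fin 4 → ℝ) →ₗ[ℝ] (Fin 4 → ℝ) →ₗ[ℝ] (Fin 4 → ℝ) →ₗ[ℝ] ℝ)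
    (x y z y' : Fin 4 → ℝ) : ℝ :=
  B x z (x - y) + B y z (x - y) + B y y (z - y')

/-- The polar form of the cubic form belonging to the decomposition
`x = (x - y) + (y - e) + e` of its argument, where `x - y`, `y - e`, and `e` are the parts along
`c_K`, along `c_m`, and along an edge. It is quadratic in `(x, y, e)` and linear in
`(z, y', e')`. -/
def polarForm (B : (Fin 4 → ℝ) →ₗ[ℝ] (Fin 4 → ℝ) →ₗ[ℝ] (Fin 4 → ℝ) →ₗ[ℝ] ℝ)
    (x y e z y' e' : Fin 4 → ℝ) : ℝ :=
  coneForm B x y z y' + coneForm B y e y' e' + B e e e'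

variable {B : (Fin 4 → ℝ) →ₗ[ℝ] (Fin 4 → ℝ) →ₗ[ℝ] (Fin 4 → ℝ) →ₗ[ℝ] ℝ}

theorem coneForm_add_smul (hB : ∀ x y, B x y = B y x) {κ x y z y' : Fin 4 → ℝ} {τ τ' : ℝ}
    (hx : x = τ • κ + y) (hz : z = τ' • κ + y') (s : ℝ) :
    coneForm B (x + s • z) (y + s • y') (x + s • z) (y + s • y') =
      coneForm B x y x y + 3 * s * coneForm B x y z y' +
        (3 * s ^ 2 * coneForm B z y' x y + s ^ 3 * coneForm B z y' z y') := by
  subst hx hz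
  have r1 := hB y κ
  have r2 := hB y' κ
  have r3 := hB y' y
  simp only [coneForm, map_add, map_sub, map_smul, LinearMap.add_apply, LinearMap.smul_apply,
    smul_eq_mul, r1, r2, r3]
  ring

theorem polarForm_add_smul (hB : ∀ x y, B x y = B y x) {κ c e e' : Fin 4 → ℝ}
    (h1 : B e e' e = B e e e') (h2 : B e' e e' = B e' e' e) {x y z y' : Fin 4 → ℝ}
    {τ ρ τ' ρ' : ℝ} (hx : x = τ • κ + y) (hy : y = ρ • c + e) (hz : z = τ' • κ + y')
    (hy' : y' = ρ' • c + e') (s : ℝ) :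
    polarForm B (x + s • z) (y + s • y') (e + s • e') (x + s • z) (y + s • y') (e + s • e') =
      polarForm B x y e x y e + 3 * s * polarForm B x y e z y' e' +
        (3 * s ^ 2 * polarForm B z y' e' x y e + s ^ 3 * polarForm B z y' e' z y' e') := by
  rw [polarForm, coneForm_add_smul hB hx hz, coneForm_add_smul hB hy hy']
  have r := hB e' e
  rw [r] at h2
  simp only [polarForm, map_add, map_smul, LinearMap.add_apply, LinearMap.smul_apply,
    smul_eq_mul, r]
  linear_combination 2 * s * h1 + 2 * s ^ 2 * h2

/-- The polar form depends on the decomposition of its last argument only through `y'`, and not at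
all if the decomposed point lies in the cone of `c_K` over an edge. -/
theorem polarForm_congr (x y e z y' y'' e' e'' : Fin 4 → ℝ) (h : y' = y'' ∨ y = e) :
    polarForm B x y e z y' e' = polarForm B x y e z y'' e'' := by
  rcases h with rfl | rfl <;>
  · simp only [polarForm, coneForm, map_sub, sub_self, map_zero]
    ring

/-- The derivative in the direction of `c_K`. -/
theorem polarForm_apex (hB : ∀ x y, B x y = B y x) {κ x y e : Fin 4 → ℝ} {τ : ℝ}
    (hx : x = τ • κ + y) : polarForm B x y e κ 0 0 = B x x κ := by
  subst hx
  have r := hB y κ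
  simp only [polarForm, coneForm, map_add, map_sub, map_smul, map_zero, LinearMap.add_apply,
    LinearMap.smul_apply, LinearMap.zero_apply, smul_eq_mul, r]
  ring

/-- The projection of `ℝ⁴` onto the kernel of the `i`-th coordinate along the vector `c`. -/
def projAlong (c : Fin 4 → ℝ) (i : Fin 4) : (Fin 4 → ℝ) →ₗ[ℝ] (Fin 4 → ℝ) :=
  LinearMap.id - (LinearMap.proj i : (Fin 4 → ℝ) →ₗ[ℝ] ℝ).smulRight ((c i)⁻¹ • c)

theorem projAlong_apply (c : Fin 4 → ℝ) (i : Fin 4) (x : Fin 4 → ℝ) :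
    projAlong c i x = x - (x i * (c i)⁻¹) • c := by
  simp [projAlong, smul_smul]

theorem projAlong_eq {c : Fin 4 → ℝ} {i : Fin 4} (hc : c i ≠ 0) (a : ℝ) {y : Fin 4 → ℝ}
    (hy : y i = 0) : projAlong c i (a • c + y) = y := by
  rw [projAlong_apply]
  simp [hy, hc]

theorem projAlong_apply_self {c : Fin 4 → ℝ} {i : Fin 4} (hc : c i ≠ 0) (x : Fin 4 → ℝ) :
    projAlong c i x i = 0 := by
  rw [projAlong_apply]
  simp [hc]

end Form

namespace Partition

variable (W : Partition) (S : Fin 4 → Fin 4 → Fin 4 → ℝ)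

/-- The part of a vector of barycentric coordinates in the face of a subtetrahedron, after splitting
off a multiple of `c_K`. -/
def facePart (t : SubTet) : (Fin 4 → ℝ) →ₗ[ℝ] (Fin 4 → ℝ) := projAlong (W.bar W.cK) t.1.2

/-- The part of a vector of barycentric coordinates in the edge of a subtetrahedron, after splitting
off multiples of `c_K` and `c_m`. -/
def edgePart (t : SubTet) : (Fin 4 → ℝ) →ₗ[ℝ] (Fin 4 → ℝ) :=
  projAlong (W.bar (W.c t.1.2)) (opp t) ∘ₗ W.facePart t

theorem bar_cK_ne_zero (j : Fin 4) : W.bar W.cK j ≠ 0 := (W.coord_cK_pos j).ne'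

theorem bar_c_ne_zero (t : SubTet) : W.bar (W.c t.1.2) (opp t) ≠ 0 :=
  (W.coord_c_pos (opp_spec t).1).ne'

theorem bar_c_self (m : Fin 4) : W.bar (W.c m) m = 0 := W.coord_c_self m

theorem eq_facePart (t : SubTet) (X : Fin 4 → ℝ) :
    X = (X t.1.2 * (W.bar W.cK t.1.2)⁻¹) • W.bar W.cK + W.facePart t X := by
  rw [facePart, projAlong_apply]; abel

theorem facePart_eq (t : SubTet) (X : Fin 4 → ℝ) :
    W.facePart t X = (W.facePart t X (opp t) * (W.bar (W.c t.1.2) (opp t))⁻¹) • W.bar (W.c t.1.2) +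
      W.edgePart t X := by
  rw [edgePart, LinearMap.comp_apply, projAlong_apply]; abel

theorem edgePart_apply_eq_zero (t : SubTet) (X : Fin 4 → ℝ) (l : Fin 4)
    (hl : l ≠ t.1.1.1.1 ∧ l ≠ t.1.1.1.2) : W.edgePart t X l = 0 := by
  rcases index_cases t l with h | h | h | h
  · have h1 : W.facePart t X t.1.2 = 0 := projAlong_apply_self (W.bar_cK_ne_zero _) X
    rw [h, edgePart, LinearMap.comp_apply, projAlong_apply]
    simp [h1, W.bar_c_self]
  · rw [h, edgePart, LinearMap.comp_apply]
    exact projAlong_apply_self (W.bar_c_ne_zero t) _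
  · exact absurd h hl.1
  · exact absurd h hl.2

/-- The parts of a vector with a given decomposition. -/
theorem parts_eq {t : SubTet} {τ ρ : ℝ} {e : Fin 4 → ℝ} (hem : e t.1.2 = 0) (hei : e (opp t) = 0) :
    W.facePart t (τ • W.bar W.cK + (ρ • W.bar (W.c t.1.2) + e)) =
      ρ • W.bar (W.c t.1.2) + e ∧
    W.edgePart t (τ • W.bar W.cK + (ρ • W.bar (W.c t.1.2) + e)) = e := by
  have h1 : W.facePart t (τ • W.bar W.cK + (ρ • W.bar (W.c t.1.2) + e)) =
      ρ • W.bar (W.c t.1.2) + e :=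
    projAlong_eq (W.bar_cK_ne_zero _) _ (by simp [hem, W.bar_c_self])
  refine ⟨h1, ?_⟩
  rw [edgePart, LinearMap.comp_apply, h1]
  exact projAlong_eq (W.bar_c_ne_zero t) _ hei

/-- One third of the derivative of the cubic polynomial `piece`. -/
def pieceDeriv (t : SubTet) (X Z : Fin 4 → ℝ) : ℝ :=
  polarForm (triForm S) X (W.facePart t X) (W.edgePart t X) Z (W.facePart t Z) (W.edgePart t Z)

/-- The cubic polynomial on a subtetrahedron with coefficients `S`. -/
def piece (t : SubTet) (x : E3) : ℝ := W.pieceDeriv S t (W.bar x) (W.bar x)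

theorem isPoly_bar_comp (M : (Fin 4 → ℝ) →ₗ[ℝ] (Fin 4 → ℝ)) (j : Fin 4) :
    IsPoly 1 fun x => M (W.bar x) j := by
  have h : (fun x => M (W.bar x) j) =
      fun x => ∑ l, M (Pi.single l 1) j * W.basis.coord l x := by
    funext x
    have h1 : W.bar x = ∑ l, W.basis.coord l x • Pi.single l (1 : ℝ) := by
      funext j
      simp [bar, Pi.single_apply]
    rw [h1, map_sum]
    simp [mul_comm]
  rw [h]
  exact IsPoly.sum fun l _ => by
    simpa using (IsPoly.const (k := 0) _).mul (IsPoly.affine (W.basis.coord l))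

theorem isPoly_piece (t : SubTet) : IsPoly 3 (W.piece S t) := by
  have h1 := W.isPoly_bar_comp LinearMap.id
  have h2 := W.isPoly_bar_comp (W.facePart t)
  have h3 := W.isPoly_bar_comp (W.edgePart t)
  have h4 := W.isPoly_bar_comp (LinearMap.id - W.facePart t)
  have h5 := W.isPoly_bar_comp (W.facePart t - W.edgePart t)
  simp only [LinearMap.id_apply, LinearMap.sub_apply] at h1 h4 h5
  exact ((((isPoly_triForm h1 h1 h4).add (isPoly_triForm h2 h1 h4)).add
    (isPoly_triForm h2 h2 h4)).add (((isPoly_triForm h2 h2 h5).add (isPoly_triForm h3 h2 h5)).add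
    (isPoly_triForm h3 h3 h5))).add (isPoly_triForm h3 h3 h3)

variable {S}

theorem hasDerivAt_piece (hS : ∀ j k l, S j k l = S k j l) (hH : ∀ j k, S j k j = S j j k)
    (t : SubTet) (x v : E3) :
    HasDerivAt (fun s : ℝ => W.piece S t (x + s • v)) (3 * W.pieceDeriv S t (W.bar x) (W.barVec v))
      0 := by
  have h : (fun s : ℝ => W.piece S t (x + s • v)) = fun s : ℝ => W.piece S t x +
      3 * s * W.pieceDeriv S t (W.bar x) (W.barVec v) +
      (3 * s ^ 2 * W.pieceDeriv S t (W.barVec v) (W.bar x) +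
        s ^ 3 * W.pieceDeriv S t (W.barVec v) (W.barVec v)) := by
    funext s
    have he := W.edgePart_apply_eq_zero t
    simp only [piece, pieceDeriv, bar_add_smul, map_add, map_smul]
    exact polarForm_add_smul (triForm_comm hS)
      (triForm_edge hH t.1.1.2.ne (he (W.bar x)) (he (W.barVec v)))
      (triForm_edge hH t.1.1.2.ne (he (W.barVec v)) (he (W.bar x)))
      (W.eq_facePart t _) (W.facePart_eq t _) (W.eq_facePart t _) (W.facePart_eq t _) s
  rw [h]
  have hs := hasDerivAt_id (0 : ℝ)
  have h1 := ((hs.const_mul 3).mul_const (W.pieceDeriv S t (W.bar x) (W.barVec v))).const_add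
    (W.piece S t x)
  have h2 := ((hs.pow 2).const_mul 3).mul_const (W.pieceDeriv S t (W.barVec v) (W.bar x))
  have h3 := (hs.pow 3).mul_const (W.pieceDeriv S t (W.barVec v) (W.barVec v))
  convert! h1.add (h2.add h3) using 1
  simp

theorem fderiv_piece (hS : ∀ j k l, S j k l = S k j l) (hH : ∀ j k, S j k j = S j j k)
    (t : SubTet) (x v : E3) :
    fderiv ℝ (W.piece S t) x v = 3 * W.pieceDeriv S t (W.bar x) (W.barVec v) := by
  have h := ((W.isPoly_piece S t).contDiff.differentiable one_ne_zero x).hasFDerivAt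
  exact (h.hasLineDerivAt v).unique (W.hasDerivAt_piece hS hH t x v)

/-- The values and derivatives of the pieces agree on the intersections of the subtetrahedra. -/
theorem pieceDeriv_eq {t t' : SubTet} {x : E3} (hx : x ∈ W.subTet t) (hx' : x ∈ W.subTet t')
    (Z : Fin 4 → ℝ) : W.pieceDeriv S t (W.bar x) Z = W.pieceDeriv S t' (W.bar x) Z := by
  obtain ⟨τ, ρ, e, -, h1, h2, h3, h4, h5⟩ := W.bar_of_mem_subTet hx
  obtain ⟨τ', ρ', e', -, h1', h2', h3', h4', h5'⟩ := W.bar_of_mem_subTet hx'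
  obtain ⟨a1, a2⟩ := W.parts_eq (τ := τ) (ρ := ρ) h3 h4
  obtain ⟨b1, b2⟩ := W.parts_eq (τ := τ') (ρ := ρ') h3' h4'
  rw [← h5] at a1 a2
  rw [← h5'] at b1 b2
  obtain ⟨-, he, h⟩ := W.decomposition_unique h1 h2 h3 h4 h1' h2' h3' h4' (h5.symm.trans h5')
  have hy : W.facePart t (W.bar x) = W.facePart t' (W.bar x) := by
    rw [a1, b1, he]
    rcases h with ⟨hm, hρ⟩ | ⟨h, h'⟩
    · rw [hm, hρ]
    · rw [h, h', zero_smul, zero_smul]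
  rw [pieceDeriv, pieceDeriv, ← hy, b2, a2, ← he]
  refine polarForm_congr _ _ _ _ _ _ _ _ ?_
  rcases h with ⟨hm, -⟩ | ⟨h, -⟩
  · left; rw [facePart, facePart, hm]
  · right; rw [a1, h, zero_smul, zero_add]

theorem exists_piecewise (hS : ∀ j k l, S j k l = S k j l) (hH : ∀ j k, S j k j = S j j k) :
    ∃ f : W.K → ℝ, f ∈ W.space ∧ ∀ t, ∀ x ∈ W.subTet t, ext f x = W.piece S t x ∧
      HasFDerivWithinAt (ext f) (fderiv ℝ (W.piece S t) x) W.K x := by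
  obtain ⟨f, hf, hft⟩ := exists_glue W.uniqueDiffOn W.isClosed_subTet W.K_eq_iUnion
    (p := fun t => W.piece S t) (fun t => (W.isPoly_piece S t).contDiff)
    (fun t t' x hx hx' => ⟨W.pieceDeriv_eq hx hx' _, by
      ext v
      rw [W.fderiv_piece hS hH, W.fderiv_piece hS hH, W.pieceDeriv_eq hx hx']⟩)
  refine ⟨f, ⟨hf, ?_⟩, hft⟩
  rintro _ ⟨t, rfl⟩
  obtain ⟨p, hp, hFp⟩ := W.isPoly_piece S t
  exact ⟨p, hp, fun x hx => by rw [← ext_apply f x, (hft t x hx).1, hFp]⟩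

/-- On an edge, the form is given by the coefficients. -/
theorem pieceDeriv_edge {t : SubTet} {X : Fin 4 → ℝ} (hm : X t.1.2 = 0) (hi : X (opp t) = 0)
    (Z : Fin 4 → ℝ) : W.pieceDeriv S t X Z = triForm S X X Z := by
  obtain ⟨a1, a2⟩ := W.parts_eq (τ := 0) (ρ := 0) hm hi
  simp only [zero_smul, zero_add] at a1 a2
  rw [pieceDeriv, a1, a2]
  simp only [polarForm, coneForm, sub_self, map_zero, map_sub]
  ring

theorem pieceDeriv_apex (hS : ∀ j k l, S j k l = S k j l) (t : SubTet) (X : Fin 4 → ℝ) :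
    W.pieceDeriv S t X (W.bar W.cK) = triForm S X X (W.bar W.cK) := by
  obtain ⟨a1, a2⟩ := W.parts_eq (t := t) (τ := 1) (ρ := 0) (e := 0) rfl rfl
  simp only [one_smul, zero_smul, add_zero] at a1 a2
  rw [pieceDeriv, a1, a2]
  exact polarForm_apex (triForm_comm hS) (W.eq_facePart t X)

end Partition

/-! ### Hermite interpolation on the edges -/

theorem hermite_mid {p : Polynomial ℝ} (hp : p.natDegree ≤ 3) :
    p.eval (1 / 2) = (p.eval 0 + p.eval 1) / 2 +
      (p.derivative.eval 0 - p.derivative.eval 1) / 8 ∧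
    p.derivative.eval (1 / 2) = 3 / 2 * (p.eval 1 - p.eval 0) -
      (p.derivative.eval 0 + p.derivative.eval 1) / 4 := by
  have h := p.as_sum_range_C_mul_X_pow' (Nat.lt_succ_of_le hp)
  simp only [Finset.sum_range_succ, Finset.sum_range_zero] at h
  rw [h]
  simp
  constructor <;> ring

theorem exists_hermite (f₀ f₁ d₀ d₁ : ℝ) : ∃ p : Polynomial ℝ, p.natDegree ≤ 3 ∧
    p.eval 0 = f₀ ∧ p.eval 1 = f₁ ∧ p.derivative.eval 0 = d₀ ∧ p.derivative.eval 1 = d₁ := by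
  open Polynomial in
  refine ⟨C (2 * (f₀ - f₁) + d₀ + d₁) * X ^ 3 + C (3 * (f₁ - f₀) - 2 * d₀ - d₁) * X ^ 2 +
    C d₀ * X + C f₀, natDegree_cubic_le, ?_, ?_, ?_, ?_⟩
  · simp
  · simp; ring
  · simp
  · simp; ring

namespace Partition

variable {W : Partition} {ν : W.EdgeNormals} {x : Fin 28 → ℝ} {v : Edge → ℝ} {G : Edge → E3}

theorem isPreprocessed_iff : IsPreprocessed ν x v G ↔ ∀ e : Edge,
    (v e = (vertexValue x e.1.1 + vertexValue x e.1.2) / 2 +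
      (inner ℝ (vertexGrad x e.1.1) (W.edgeVec e) - inner ℝ (vertexGrad x e.1.2) (W.edgeVec e)) / 8 ∧
    inner ℝ (G e) (W.edgeVec e) = 3 / 2 * (vertexValue x e.1.2 - vertexValue x e.1.1) -
      (inner ℝ (vertexGrad x e.1.1) (W.edgeVec e) +
        inner ℝ (vertexGrad x e.1.2) (W.edgeVec e)) / 4) ∧
    ∀ i : Fin 2, inner ℝ (G e) (ν.vec e i) = x (dofNumber (.inr (.inr (e, i)))) := by
  refine forall_congr' fun e => and_congr_left fun _ => ?_
  constructor
  · rintro ⟨p, hp, h0, h1, h2, h3, h4, h5⟩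
    obtain ⟨b1, b2⟩ := hermite_mid hp
    rw [h4, h5, b1, b2, h0, h1, h2, h3]
    exact ⟨rfl, rfl⟩
  · rintro ⟨h4, h5⟩
    obtain ⟨p, hp, h0, h1, h2, h3⟩ := exists_hermite (vertexValue x e.1.1) (vertexValue x e.1.2)
      (inner ℝ (vertexGrad x e.1.1) (W.edgeVec e)) (inner ℝ (vertexGrad x e.1.2) (W.edgeVec e))
    obtain ⟨b1, b2⟩ := hermite_mid hp
    refine ⟨p, hp, h0, h1, h2, h3, ?_, ?_⟩
    · rw [h4, b1, h0, h1, h2, h3]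
    · rw [h5, b2, h0, h1, h2, h3]

/-- A vector is determined by its inner products with the three vectors of an edge. -/
theorem eq_of_inner_eq (ν : W.EdgeNormals) (e : Edge) {g g' : E3}
    (h0 : inner ℝ g (W.edgeVec e) = (inner ℝ g' (W.edgeVec e) : ℝ))
    (h : ∀ i, inner ℝ g (ν.vec e i) = (inner ℝ g' (ν.vec e i) : ℝ)) : g = g' := by
  have h1 : Submodule.span ℝ {W.edgeVec e, ν.vec e 0, ν.vec e 1} ≤
      LinearMap.ker (innerₛₗ ℝ (g - g')) := by
    rw [Submodule.span_le]
    rintro _ (rfl | rfl | rfl) <;>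
      simp only [SetLike.mem_coe, LinearMap.mem_ker, innerₛₗ_apply_apply, inner_sub_left, h0, h,
        sub_self]
  rw [ν.span_eq_top] at h1
  have h2 : inner ℝ (g - g') (g - g') = (0 : ℝ) := h1 (Submodule.mem_top (x := g - g'))
  exact sub_eq_zero.1 (inner_self_eq_zero.1 h2)

theorem exists_inner_eq (ν : W.EdgeNormals) (e : Edge) (a : ℝ) (b : Fin 2 → ℝ) :
    ∃ g : E3, inner ℝ g (W.edgeVec e) = a ∧ ∀ i, inner ℝ g (ν.vec e i) = b i := by
  set T : E3 →ₗ[ℝ] (Fin 3 → ℝ) := LinearMap.pi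
    ![innerₛₗ ℝ (W.edgeVec e), innerₛₗ ℝ (ν.vec e 0), innerₛₗ ℝ (ν.vec e 1)] with hT
  have hinj : Function.Injective T := by
    intro g g' h
    have h0 := congrFun h 0
    have h1 := congrFun h 1
    have h2 := congrFun h 2
    simp only [hT, LinearMap.pi_apply, Matrix.cons_val, innerₛₗ_apply_apply] at h0 h1 h2
    refine eq_of_inner_eq ν e ?_ fun i => ?_
    · rw [real_inner_comm, h0, real_inner_comm]
    · fin_cases i
      · change inner ℝ g (ν.vec e 0) = inner ℝ g' (ν.vec e 0)
        rw [real_inner_comm, h1, real_inner_comm]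
      · change inner ℝ g (ν.vec e 1) = inner ℝ g' (ν.vec e 1)
        rw [real_inner_comm, h2, real_inner_comm]
  have hsurj := (LinearMap.injective_iff_surjective_of_finrank_eq_finrank (by simp)).1 hinj
  obtain ⟨g, hg⟩ := hsurj ![a, b 0, b 1]
  have h0 := congrFun hg 0
  have h1 := congrFun hg 1
  have h2 := congrFun hg 2
  simp only [hT, LinearMap.pi_apply, Matrix.cons_val, innerₛₗ_apply_apply] at h0 h1 h2
  refine ⟨g, by rw [real_inner_comm, h0], fun i => ?_⟩
  fin_cases i
  · change inner ℝ g (ν.vec e 0) = b 0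
    rw [real_inner_comm, h1]
  · change inner ℝ g (ν.vec e 1) = b 1
    rw [real_inner_comm, h2]

theorem exists_isPreprocessed (ν : W.EdgeNormals) (x : Fin 28 → ℝ) :
    ∃ v G, IsPreprocessed ν x v G := by
  have h := fun e => exists_inner_eq ν e (3 / 2 * (vertexValue x e.1.2 - vertexValue x e.1.1) -
      (inner ℝ (vertexGrad x e.1.1) (W.edgeVec e) +
        inner ℝ (vertexGrad x e.1.2) (W.edgeVec e)) / 4)
    fun i => x (dofNumber (.inr (.inr (e, i))))
  choose G hG using h
  exact ⟨_, G, isPreprocessed_iff.2 fun e => ⟨⟨rfl, (hG e).1⟩, (hG e).2⟩⟩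

theorem IsPreprocessed.unique {v' : Edge → ℝ} {G' : Edge → E3} (h : IsPreprocessed ν x v G)
    (h' : IsPreprocessed ν x v' G') : v = v' ∧ G = G' := by
  rw [isPreprocessed_iff] at h h'
  constructor
  · funext e
    rw [(h e).1.1, (h' e).1.1]
  · funext e
    exact eq_of_inner_eq ν e ((h e).1.2.trans (h' e).1.2.symm)
      fun i => ((h e).2 i).trans ((h' e).2 i).symm

/-! ### The spline with given data -/

/-- The value at `Q_l` of the affine function `Z ↦ f(Q_j) + ∇f(Q_j) · (Z - Q_j) / 3`. -/
def vertexJet (W : Partition) (x : Fin 28 → ℝ) (j l : Fin 4) : ℝ :=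
  vertexValue x j + inner ℝ (vertexGrad x j) (W.Q l - W.Q j) / 3

/-- The value at `Q_l` of the affine function `Z ↦ f(M) + ∇f(M) · (Z - M) / 3`, where `M` is the
midpoint of the edge `e`. -/
def midJet (W : Partition) (v : Edge → ℝ) (G : Edge → E3) (e : Edge) (l : Fin 4) : ℝ :=
  v e + inner ℝ (G e) (W.Q l - W.mid e) / 3

/-- The polarization of the jets at the endpoints and the midpoint of an edge. -/
def edgeJet (W : Partition) (x : Fin 28 → ℝ) (v : Edge → ℝ) (G : Edge → E3) (e : Edge)
    (l : Fin 4) : ℝ :=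
  (4 * W.midJet v G e l - W.vertexJet x e.1.1 l - W.vertexJet x e.1.2 l) / 2

/-- The coefficients `b(Q_j, Q_k, Q_l)` of the spline with given data, in terms of the blossom `b` of
a cubic piece which contains the edge from `Q_j` to `Q_k`. -/
def coeff (W : Partition) (x : Fin 28 → ℝ) (v : Edge → ℝ) (G : Edge → E3) (j k l : Fin 4) : ℝ :=
  if h : j < k then W.edgeJet x v G ⟨(j, k), h⟩ l
  else if h : k < j then W.edgeJet x v G ⟨(k, j), h⟩ l
  else W.vertexJet x j l

theorem coeff_edge (e : Edge) (l : Fin 4) : W.coeff x v G e.1.1 e.1.2 l = W.edgeJet x v G e l :=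
  dif_pos e.2

theorem coeff_self (j l : Fin 4) : W.coeff x v G j j l = W.vertexJet x j l := by
  simp [coeff]

theorem coeff_comm (j k l : Fin 4) : W.coeff x v G j k l = W.coeff x v G k j l := by
  rcases lt_trichotomy j k with h | rfl | h
  · simp [coeff, h, h.not_gt]
  · rfl
  · simp [coeff, h, h.not_gt]

theorem IsPreprocessed.edgeJet_eq (h : IsPreprocessed ν x v G) (e : Edge) :
    W.edgeJet x v G e e.1.1 = W.vertexJet x e.1.1 e.1.2 ∧
    W.edgeJet x v G e e.1.2 = W.vertexJet x e.1.2 e.1.1 := by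
  obtain ⟨⟨h1, h2⟩, -⟩ := isPreprocessed_iff.1 h e
  have a1 : W.Q e.1.1 - W.mid e = -((1 / 2 : ℝ) • W.edgeVec e) := by rw [mid, edgeVec]; module
  have a2 : W.Q e.1.2 - W.mid e = (1 / 2 : ℝ) • W.edgeVec e := by rw [mid, edgeVec]; module
  have a3 : W.Q e.1.2 - W.Q e.1.1 = W.edgeVec e := rfl
  have a4 : W.Q e.1.1 - W.Q e.1.2 = -W.edgeVec e := by rw [edgeVec]; abel
  simp only [edgeJet, midJet, vertexJet, a1, a2, a3, a4, inner_neg_right, inner_smul_right,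
    sub_self, inner_zero_right, h1, h2]
  constructor <;> ring

theorem IsPreprocessed.coeff_swap (h : IsPreprocessed ν x v G) (j k : Fin 4) :
    W.coeff x v G j k j = W.coeff x v G j j k := by
  rcases lt_trichotomy j k with hjk | rfl | hjk
  · have h1 := coeff_edge (W := W) (x := x) (v := v) (G := G) ⟨(j, k), hjk⟩ j
    exact h1.trans ((h.edgeJet_eq ⟨(j, k), hjk⟩).1.trans (coeff_self j k).symm)
  · rfl
  · have h1 := coeff_edge (W := W) (x := x) (v := v) (G := G) ⟨(k, j), hjk⟩ j
    exact (coeff_comm j k j).trans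
      (h1.trans ((h.edgeJet_eq ⟨(k, j), hjk⟩).2.trans (coeff_self j k).symm))

theorem sum_bar_mul_affine (a : ℝ) (g p y : E3) :
    ∑ l, (a + inner ℝ g (W.Q l - p) / 3) * W.bar y l = a + inner ℝ g (y - p) / 3 := by
  have h1 : ∑ l, W.bar y l = 1 := W.sum_coord y
  have h2 : y - p = ∑ l, W.bar y l • (W.Q l - p) := by
    simp only [smul_sub, Finset.sum_sub_distrib, ← Finset.sum_smul, h1, one_smul]
    congr 1
    exact (W.sum_coord_smul y).symm
  rw [h2, inner_sum]
  simp only [inner_smul_right, add_mul, Finset.sum_add_distrib, ← Finset.mul_sum, h1, mul_one,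
    Finset.sum_div]
  congr 1
  exact Finset.sum_congr rfl fun l _ => by ring

theorem sum_barVec_mul_affine (a : ℝ) (g p s : E3) :
    ∑ l, (a + inner ℝ g (W.Q l - p) / 3) * W.barVec s l = inner ℝ g s / 3 := by
  have h1 : ∑ l, W.barVec s l = 0 := W.sum_barVec s
  have h2 : s = ∑ l, W.barVec s l • (W.Q l - p) := by
    simp only [smul_sub, Finset.sum_sub_distrib, ← Finset.sum_smul, h1, zero_smul, sub_zero]
    exact (W.sum_barVec_smul s).symm
  conv_rhs => rw [h2, inner_sum]
  simp only [inner_smul_right, add_mul, Finset.sum_add_distrib, ← Finset.mul_sum, h1, mul_zero,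
    Finset.sum_div, zero_add]
  exact Finset.sum_congr rfl fun l _ => by ring

theorem triForm_single_single (S : Fin 4 → Fin 4 → Fin 4 → ℝ) (j k : Fin 4) (Z : Fin 4 → ℝ) :
    triForm S (Pi.single j 1) (Pi.single k 1) Z = ∑ l, S j k l * Z l := by
  simp [triForm_apply, Pi.single_apply]

theorem triForm_Q (j : Fin 4) (Z : Fin 4 → ℝ) :
    triForm (W.coeff x v G) (W.bar (W.Q j)) (W.bar (W.Q j)) Z =
      ∑ l, W.vertexJet x j l * Z l := by
  simp only [bar_Q, triForm_single_single, coeff_self]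

theorem bar_mid (e : Edge) :
    W.bar (W.mid e) = (1 / 2 : ℝ) • (Pi.single e.1.1 1 + Pi.single e.1.2 1) := by
  have h := W.bar_sum (n := 2) ![W.Q e.1.1, W.Q e.1.2] (w := ![1 / 2, 1 / 2])
    (by rw [Fin.sum_univ_two]; norm_num)
  simp only [Fin.sum_univ_two, Matrix.cons_val_zero, Matrix.cons_val_one, bar_Q] at h
  rw [mid, smul_add, h, smul_add]

theorem triForm_mid (e : Edge) (Z : Fin 4 → ℝ) :
    triForm (W.coeff x v G) (W.bar (W.mid e)) (W.bar (W.mid e)) Z =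
      ∑ l, W.midJet v G e l * Z l := by
  simp only [bar_mid, map_smul, map_add, LinearMap.smul_apply, LinearMap.add_apply,
    triForm_single_single, coeff_self, coeff_comm e.1.2 e.1.1, coeff_edge, smul_eq_mul]
  simp only [← Finset.sum_add_distrib, Finset.mul_sum]
  refine Finset.sum_congr rfl fun l _ => ?_
  rw [edgeJet]
  ring

theorem pieceDeriv_sub (S : Fin 4 → Fin 4 → Fin 4 → ℝ) (t : SubTet) (X Z Z' : Fin 4 → ℝ) :
    W.pieceDeriv S t X (Z - Z') = W.pieceDeriv S t X Z - W.pieceDeriv S t X Z' := by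
  simp only [pieceDeriv, polarForm, coneForm, map_sub, LinearMap.sub_apply]
  ring

theorem isPoly_apex (W : Partition) (S : Fin 4 → Fin 4 → Fin 4 → ℝ) :
    IsPoly 2 fun y => triForm S (W.bar y) (W.bar y) (W.bar W.cK) := by
  have h1 : ∀ j, IsPoly 1 fun y => W.bar y j := W.isPoly_bar_comp LinearMap.id
  have h2 : ∀ j, IsPoly 0 fun _ : E3 => W.bar W.cK j := fun j => IsPoly.const _
  exact isPoly_triForm (w := fun _ => W.bar W.cK) h1 h1 h2

/-- Every set of degrees of freedom is attained by a spline. The last part says that the ordinates of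
the spline which involve `c_K` are those of the quadratic interpolation polynomial. -/
theorem exists_spline (h : IsPreprocessed ν x v G) : ∃ f : W.K → ℝ, f ∈ W.space ∧
    (∀ j, ext f (W.Q j) = vertexValue x j ∧ ∃ D : E3 →L[ℝ] ℝ,
      HasFDerivWithinAt (ext f) D W.K (W.Q j) ∧ ∀ s, D s = inner ℝ (vertexGrad x j) s) ∧
    (∀ e, ext f (W.mid e) = v e ∧ ∃ D : E3 →L[ℝ] ℝ,
      HasFDerivWithinAt (ext f) D W.K (W.mid e) ∧ ∀ s, D s = inner ℝ (G e) s) ∧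
    ∃ g, W.IsQuadraticInterpolation x v G g ∧ ∀ y ∈ W.K, ∃ D : E3 →L[ℝ] ℝ,
      HasFDerivWithinAt (ext f) D W.K y ∧ ext f y + D (W.cK - y) / 3 = polyVal g y := by
  set S := W.coeff x v G with hSdef
  have hS : ∀ j k l, S j k l = S k j l := coeff_comm
  have hH : ∀ j k, S j k j = S j j k := h.coeff_swap
  obtain ⟨f, hf, hft⟩ := W.exists_piecewise hS hH
  have hQ : ∀ j : Fin 4, ∃ t : SubTet, j ≠ t.1.2 ∧ j ≠ opp t ∧ (j = t.1.1.1.1 ∨ j = t.1.1.1.2) := by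
    decide
  have hE : ∀ e : Edge, ∃ t : SubTet, t.1.1 = e := by decide
  refine ⟨f, hf, fun j => ?_, fun e => ?_, ?_⟩
  · obtain ⟨t, hm, hi, hj⟩ := hQ j
    have hmem : W.Q j ∈ W.subTet t := by
      refine subset_convexHull ℝ _ ?_
      rcases hj with rfl | rfl <;> simp
    obtain ⟨h1, h2⟩ := hft t _ hmem
    have h3 : ∀ Z, W.pieceDeriv S t (W.bar (W.Q j)) Z = ∑ l, W.vertexJet x j l * Z l := by
      intro Z
      rw [W.pieceDeriv_edge (by rw [bar_Q, Pi.single_eq_of_ne hm.symm])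
        (by rw [bar_Q, Pi.single_eq_of_ne hi.symm]), triForm_Q]
    refine ⟨?_, _, h2, fun s => ?_⟩
    · rw [h1, piece, h3]
      simp only [vertexJet, sum_bar_mul_affine]
      simp
    · rw [W.fderiv_piece hS hH, h3]
      simp only [vertexJet, sum_barVec_mul_affine]
      ring
  · obtain ⟨t, rfl⟩ := hE e
    have hmem : W.mid t.1.1 ∈ W.subTet t := by
      have h1 := (convex_convexHull ℝ _) (subset_convexHull ℝ
        {W.Q t.1.1.1.1, W.Q t.1.1.1.2, W.cK, W.c t.1.2} (by simp : W.Q t.1.1.1.1 ∈ _))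
        (subset_convexHull ℝ _ (by simp : W.Q t.1.1.1.2 ∈ _))
        (a := (1 / 2 : ℝ)) (b := (1 / 2 : ℝ)) (by norm_num) (by norm_num) (by norm_num)
      rwa [← smul_add] at h1
    obtain ⟨h1, h2⟩ := hft t _ hmem
    have h3 : ∀ Z, W.pieceDeriv S t (W.bar (W.mid t.1.1)) Z =
        ∑ l, W.midJet v G t.1.1 l * Z l := by
      intro Z
      rw [W.pieceDeriv_edge ?_ ?_, triForm_mid]
      · simp [bar_mid, Pi.single_eq_of_ne t.2.1, Pi.single_eq_of_ne t.2.2]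
      · simp [bar_mid, Pi.single_eq_of_ne (opp_spec t).2.1, Pi.single_eq_of_ne (opp_spec t).2.2]
    refine ⟨?_, _, h2, fun s => ?_⟩
    · rw [h1, piece, h3]
      simp only [midJet, sum_bar_mul_affine]
      simp
    · rw [W.fderiv_piece hS hH, h3]
      simp only [midJet, sum_barVec_mul_affine]
      ring
  · obtain ⟨g, hg, hgp⟩ := W.isPoly_apex S
    replace hgp : ∀ y, triForm S (W.bar y) (W.bar y) (W.bar W.cK) = polyVal g y := hgp
    refine ⟨g, ⟨hg, fun l => ?_, fun e => ?_⟩, fun y hy => ?_⟩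
    · rw [← hgp, triForm_Q]
      simp only [vertexJet, sum_bar_mul_affine]
      rw [← neg_sub (W.Q l), inner_neg_right, real_inner_comm]
      ring
    · rw [← hgp, triForm_mid]
      simp only [midJet, sum_bar_mul_affine]
      rw [real_inner_comm]
      ring
    · rw [K_eq_iUnion] at hy
      obtain ⟨t, ht⟩ := mem_iUnion.1 hy
      obtain ⟨h1, h2⟩ := hft t y ht
      refine ⟨_, h2, ?_⟩
      rw [h1, W.fderiv_piece hS hH, barVec_sub, pieceDeriv_sub, ← hgp, ← W.pieceDeriv_apex hS t,
        piece]
      ring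


/-! ### The algorithm -/

variable {W : Partition} {ν : W.EdgeNormals} {x : Fin 28 → ℝ} {v : Edge → ℝ} {G : Edge → E3}

theorem range_vertices (W : Partition) (σ : LocalEnum) (t : SubTet) :
    range (W.vertices σ t) = {W.Q t.1.1.1.1, W.Q t.1.1.1.2, W.cK, W.c t.1.2} := by
  have h : ∀ s : Equiv.Perm (Fin 2), s 0 = 0 ∧ s 1 = 1 ∨ s 0 = 1 ∧ s 1 = 0 := by decide
  rw [vertices, range_four]
  rcases h (σ t) with ⟨h0, h1⟩ | ⟨h0, h1⟩ <;> rw [h0, h1] <;>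
  · ext y
    simp only [mem_insert_iff, mem_singleton_iff, Matrix.cons_val_zero, Matrix.cons_val_one]
    tauto

theorem convexHull_range_vertices (W : Partition) (σ : LocalEnum) (t : SubTet) :
    convexHull ℝ (range (W.vertices σ t)) = W.subTet t := by
  rw [range_vertices, subTet]

theorem triangle_subset_subTet (W : Partition) {m : Fin 4} {e : Edge} (h1 : m ≠ e.1.1)
    (h2 : m ≠ e.1.2) :
    convexHull ℝ {W.c m, W.Q e.1.1, W.Q e.1.2} ⊆ W.subTet ⟨(e, m), h1, h2⟩ := by
  refine convexHull_mono ?_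
  rintro _ (rfl | rfl | rfl) <;> simp

/-- The spline with given degrees of freedom is an output of the algorithm, with its own restrictions to
the faces as the Hsieh-Clough-Tocher functions. -/
theorem exists_isAlgorithmOutput (ν : W.EdgeNormals) (σ : LocalEnum) (x : Fin 28 → ℝ) :
    ∃ c f, IsAlgorithmOutput ν σ x c f ∧ ∃ hf : f ∈ W.space, ∀ μ, dof ν μ ⟨f, hf⟩ = x μ := by
  obtain ⟨v, G, hpre⟩ := exists_isPreprocessed ν x
  obtain ⟨f, hf, hfv, hfm, g, hg, hgf⟩ := exists_spline hpre
  have hpoly : ∀ t : SubTet, ∃ p : MvPolynomial (Fin 3) ℝ, p.totalDegree ≤ 3 ∧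
      ∀ y ∈ W.subTet t, ext f y = polyVal p y := fun t => by
    obtain ⟨p, hp, hfp⟩ := hf.2 _ (mem_range_self t)
    exact ⟨p, hp, fun y hy => (ext_apply f ⟨y, W.subTet_subset_K t hy⟩).trans (hfp _ hy)⟩
  have hcub : ∀ t, IsCubicOn (ext f) (W.vertices σ t) := fun t =>
    isCubicOn_of_eq_polyVal (by rw [convexHull_range_vertices]; exact hpoly t)
  choose c hc using hcub
  have hC : ContDiffOn ℝ 1 (ext f) W.K := hf.1
  refine ⟨c, f, ⟨v, G, g, fun _ => ext f, hpre, ⟨hg, ?_⟩, fun m => ⟨?_, ?_, ?_, ?_⟩, ?_, ?_⟩, hf, ?_⟩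
  · intro t w h0 h1
    have hsub : convexHull ℝ (range (W.vertices σ t)) ⊆ W.K := by
      rw [convexHull_range_vertices]; exact W.subTet_subset_K t
    obtain ⟨D, hD, hDg⟩ := hgf _ (hsub (mem_convexHull_range.2 ⟨w, h0, h1, rfl⟩))
    have h2 := hasFDerivWithinAt_bernstein hsub (hc t) h0 h1 hD 0
    have h3 : W.vertices σ t 0 = W.cK := rfl
    rw [h3] at h2
    rw [← hDg]
    refine Eq.trans ?_ h2
    norm_num
  · exact hC.mono (W.face_subset_K m)
  · intro e h1 h2
    obtain ⟨p, hp, hfp⟩ := hpoly ⟨(e, m), h1, h2⟩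
    exact ⟨p, hp, fun y hy => hfp y (W.triangle_subset_subTet h1 h2 hy)⟩
  · intro l _
    obtain ⟨h1, D, hD, hDs⟩ := hfv l
    exact ⟨h1, fun s _ => ⟨D, hD.mono (W.face_subset_K m), hDs s⟩⟩
  · intro e _ _ s _ _
    obtain ⟨-, D, hD, hDs⟩ := hfm e
    exact ⟨D, hD.mono (W.face_subset_K m), hDs s⟩
  · intro t w h0 h1 _
    exact hc t w h0 h1
  · intro t w h0 h1 y hy
    rw [← ext_apply f y, hy, hc t w h0 h1]
  · intro μ
    obtain ⟨d, rfl⟩ := dofNumber.surjective μ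
    rw [dof_dofNumber]
    rcases d with j | ⟨l, j⟩ | ⟨e, i⟩
    · exact (ext_apply f ⟨W.Q j, W.Q_mem j⟩).symm.trans (hfv j).1
    · obtain ⟨-, D, hD, hDs⟩ := hfv j
      change fderivWithin ℝ (ext f) W.K (W.Q j) (EuclideanSpace.single l 1) = _
      rw [hD.fderivWithin (W.uniqueDiffOn _ (W.Q_mem j)), hDs]
      rw [EuclideanSpace.inner_single_right]
      simp [vertexGrad]
    · obtain ⟨-, D, hD, hDs⟩ := hfm e
      change fderivWithin ℝ (ext f) W.K (W.mid e) (ν.vec e i) = _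
      rw [hD.fderivWithin (W.uniqueDiffOn _ (W.mid_mem e)), hDs]
      exact (hpre e).2 i

/-- A quadratic polynomial is determined by its values at the vertices and midpoints of the edges. -/
theorem IsQuadraticInterpolation.unique {g g' : MvPolynomial (Fin 3) ℝ}
    (h : W.IsQuadraticInterpolation x v G g) (h' : W.IsQuadraticInterpolation x v G g') (y : E3) :
    polyVal g y = polyVal g' y := by
  have hsub : ∀ y, polyVal (g - g') y = polyVal g y - polyVal g' y := fun y => by
    simp [polyVal]
  obtain ⟨d, hd⟩ := exists_ordinates (k := 2) (g - g')
    ((MvPolynomial.totalDegree_sub _ _).trans (max_le h.1 h'.1)) W.Q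
  have h1 : ∀ j, bernstein d (Pi.single j 1) = 0 := fun j => by
    rw [← hd _ (by simp), sum_single_smul, hsub, h.2.1, h'.2.1, sub_self]
  have h2 : ∀ e : Edge, bernstein d ((1 / 2 : ℝ) • (Pi.single e.1.1 1 + Pi.single e.1.2 1)) = 0 := by
    intro e
    rw [← bar_mid (W := W), ← hd (W.bar (W.mid e)) (W.sum_coord (W.mid e))]
    have : ∑ i, W.bar (W.mid e) i • W.Q i = W.mid e := W.sum_coord_smul _
    rw [this, hsub, h.2.2, h'.2.2, sub_self]
  have h3 : ∀ j k, shift (shift d j) k (zeroIndex 4) = 0 := by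
    intro j k
    rw [← bernstein_two_polar, h1, h1]
    rcases lt_trichotomy j k with hjk | rfl | hjk
    · rw [h2 ⟨(j, k), hjk⟩]; norm_num
    · have : (1 / 2 : ℝ) • (Pi.single j 1 + Pi.single j 1 : Fin 4 → ℝ) = Pi.single j 1 := by module
      rw [this, h1]; norm_num
    · rw [add_comm, h2 ⟨(k, j), hjk⟩]; norm_num
  have h4 : polyVal (g - g') y = 0 := by
    rw [← W.sum_coord_smul y, hd _ (W.sum_coord y), bernstein_two]
    simp [h3]
  rw [hsub] at h4
  exact sub_eq_zero.1 h4

theorem HasDirDerivWithin.sub_eq {h h' : E3 → ℝ} {F : Set E3} {y s : E3} {d : ℝ}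
    (hd : HasDirDerivWithin h F y s d) (hd' : HasDirDerivWithin h' F y s d) :
    HasDirDerivWithin (h - h') F y s 0 := by
  obtain ⟨D, hD, rfl⟩ := hd
  obtain ⟨D', hD', hs⟩ := hd'
  exact ⟨D - D', hD.sub hD', by simp [hs]⟩

theorem IsHCTInterpolation.unique {m : Fin 4} {h h' : E3 → ℝ} (hh : W.IsHCTInterpolation x G m h)
    (hh' : W.IsHCTInterpolation x G m h') {e : Edge} (h1 : m ≠ e.1.1) (h2 : m ≠ e.1.2) {y : E3}
    (hy : y ∈ convexHull ℝ {W.c m, W.Q e.1.1, W.Q e.1.2}) : h y = h' y := by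
  refine sub_eq_zero.1 (W.hct_eq_zero (f := h - h') (hh.1.sub hh'.1) (fun e h1 h2 => ?_)
    (fun l hl => ⟨?_, fun s hs => ?_⟩) (fun e h1 h2 s hs hse => ?_) h1 h2 hy)
  · obtain ⟨p, hp, hfp⟩ := hh.2.1 e h1 h2
    obtain ⟨q, hq, hfq⟩ := hh'.2.1 e h1 h2
    exact ⟨p - q, (MvPolynomial.totalDegree_sub _ _).trans (max_le hp hq), fun y hy => by
      simp [hfp y hy, hfq y hy, polyVal]⟩
  · rw [Pi.sub_apply, (hh.2.2.1 l hl).1, (hh'.2.2.1 l hl).1, sub_self]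
  · exact ((hh.2.2.1 l hl).2 s hs).sub_eq ((hh'.2.2.1 l hl).2 s hs)
  · exact (hh.2.2.2 e h1 h2 s hs hse).sub_eq (hh'.2.2.2 e h1 h2 s hs hse)

theorem IsAlgorithmOutput.unique {σ : LocalEnum} {c c' : Ordinates} {f f' : W.K → ℝ}
    (h : IsAlgorithmOutput ν σ x c f) (h' : IsAlgorithmOutput ν σ x c' f') : c = c' ∧ f = f' := by
  obtain ⟨v, G, g, h, hpre, ⟨hg, hgc⟩, hh, hhc, hfc⟩ := h
  obtain ⟨v', G', g', h', hpre', ⟨hg', hgc'⟩, hh', hhc', hfc'⟩ := h'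
  obtain ⟨rfl, rfl⟩ := hpre.unique hpre'
  have hcc : c = c' := by
    funext t α
    rw [← sub_eq_zero]
    -- the quadratic polynomial determines the ordinates with first index at least one
    have h0 : ∀ β, (c t - c' t) (MultiIndex.addUnit 0 β) = 0 := fun β =>
      bernstein_eq_zero (A := univ) univ_nonempty (c := shift (c t - c' t) 0)
        (fun w h0 h1 _ => by
          have : shift (c t - c' t) 0 = shift (c t) 0 - shift (c' t) 0 := rfl
          rw [this, bernstein_sub]
          refine sub_eq_zero.2 ((hgc t w h0 h1).symm.trans (Eq.trans ?_ (hgc' t w h0 h1)))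
          exact hg.unique hg' _) β (fun i hi => absurd (mem_univ i) hi)
    by_cases hα : α.1 0 = 0
    -- the other ordinates are determined by the values on the face
    · refine bernstein_eq_zero (A := {0}ᶜ) ⟨1, by simp⟩ (c := c t - c' t)
        (fun w h0 h1 hw => ?_) α (fun i hi => ?_)
      · have hw0 : w 0 = 0 := hw 0 (by simp)
        rw [bernstein_sub, ← hhc t w h0 h1 hw0, ← hhc' t w h0 h1 hw0, sub_eq_zero]
        refine (hh t.1.2).unique (hh' t.1.2) t.2.1 t.2.2 ?_
        rw [Fin.sum_univ_succ, hw0, zero_smul, zero_add]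
        rw [Fin.sum_univ_succ, hw0, zero_add] at h1
        refine (convex_convexHull ℝ _).sum_mem (fun i _ => h0 _) h1 fun i _ =>
          subset_convexHull ℝ _ ?_
        have hs : ∀ b : Fin 2, ![t.1.1.1.1, t.1.1.1.2] b = t.1.1.1.1 ∨
            ![t.1.1.1.1, t.1.1.1.2] b = t.1.1.1.2 := by
          intro b; fin_cases b <;> simp
        fin_cases i
        · exact Or.inl rfl
        · change W.Q (![t.1.1.1.1, t.1.1.1.2] (σ t 0)) ∈ _
          rcases hs (σ t 0) with h | h <;> rw [h] <;> simp
        · change W.Q (![t.1.1.1.1, t.1.1.1.2] (σ t 1)) ∈ _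
          rcases hs (σ t 1) with h | h <;> rw [h] <;> simp
      · have : i = 0 := by simpa using hi
        rw [this, hα]
    · obtain ⟨β, rfl⟩ := α.exists_addUnit 0 hα
      exact h0 β
  refine ⟨hcc, ?_⟩
  subst hcc
  funext y
  obtain ⟨t, ht⟩ := mem_iUnion.1 (W.K_eq_iUnion.subset y.2)
  rw [← W.convexHull_range_vertices σ, mem_convexHull_range] at ht
  obtain ⟨w, h0, h1, hy⟩ := ht
  rw [hfc t w h0 h1 y hy, hfc' t w h0 h1 y hy]

theorem dof_injective (ν : W.EdgeNormals) {f g : W.space}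
    (h : ∀ μ, dof ν μ f = dof ν μ g) : f = g := by
  rw [← sub_eq_zero]
  refine Subtype.ext (funext fun y => ?_)
  obtain ⟨t, ht⟩ := mem_iUnion.1 (W.K_eq_iUnion.subset y.2)
  rw [← ext_apply (f - g).1 y]
  exact eq_zero_of_dof_eq_zero ν (f - g) (fun μ => by rw [map_sub, h, sub_self]) t ht

end Partition

/-! ### The boundary of the tetrahedron -/

/-- A maximum of finitely many Lipschitz continuous functions. -/
theorem exists_lipschitz_max {ι : Type*} {I : Finset ι} (hI : I.Nonempty) {a : ι → E3 → ℝ}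
    {C : ι → NNReal} (ha : ∀ i, LipschitzWith (C i) (a i)) :
    ∃ (φ : E3 → ℝ) (C' : NNReal), LipschitzWith C' φ ∧ ∀ z s, φ z ≤ s ↔ ∀ i ∈ I, a i z ≤ s := by
  induction hI using Finset.Nonempty.cons_induction with
  | singleton i => exact ⟨a i, C i, ha i, by simp⟩
  | cons i I hi _ ih =>
    obtain ⟨φ, C', hφ, h⟩ := ih
    refine ⟨fun z => max (a i z) (φ z), _, (ha i).max hφ, fun z s => ?_⟩
    simp only [max_le_iff, h, Finset.mem_cons, forall_eq_or_imp]

namespace Partition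

variable (W : Partition)

theorem continuous_coord (j : Fin 4) : Continuous (W.basis.coord j) :=
  AffineMap.continuous_of_finiteDimensional _

/-- Near a boundary point `x`, only the inequalities `λ_j ≥ 0` with `λ_j(x) = 0` matter. All of these
`λ_j` increase in the direction from `x` to `c_K`, so that they describe the set above the graph of
a maximum of affine functions. -/
theorem hasLipschitzBoundary : HasLipschitzBoundary W.K := by
  intro x hx
  have hcl : IsClosed W.K := ((finite_range W.Q).isCompact_convexHull ℝ).isClosed
  have hxK : x ∈ W.K := hcl.frontier_subset hx
  have hxi : x ∉ interior W.K := by rw [hcl.frontier_eq] at hx; exact hx.2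
  have hne : W.cK - x ≠ 0 := fun h => hxi (by rw [← sub_eq_zero.1 h]; exact W.cK_mem)
  set r : ℝ := ‖W.cK - x‖⁻¹ with hr
  have hr0 : 0 < r := inv_pos.2 (norm_pos_iff.2 hne)
  set u : E3 := r • (W.cK - x) with hu
  set I : Finset (Fin 4) := Finset.univ.filter fun j => W.bar x j = 0 with hI
  have hpos : ∀ j ∉ I, 0 < W.basis.coord j x := fun j hj =>
    lt_of_le_of_ne ((W.mem_K_iff x).1 hxK j) fun h => hj (by rw [hI]; exact Finset.mem_filter.2 ⟨Finset.mem_univ j, h.symm⟩)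
  have hIne : I.Nonempty := by
    rw [Finset.nonempty_iff_ne_empty]
    intro h
    exact hxi ((W.mem_interior_K_iff x).2 fun j => hpos j (by simp [h]))
  have hL : ∀ j ∈ I, 0 < (W.basis.coord j).linear u := by
    intro j hj
    have h0 : W.bar x j = 0 := by simpa [hI] using hj
    have h1 : (W.basis.coord j).linear (W.cK - x) = W.bar W.cK j - W.bar x j :=
      congrFun (W.barVec_sub W.cK x) j
    rw [hu, map_smul, h1, h0, sub_zero, smul_eq_mul]
    exact mul_pos hr0 (W.coord_cK_pos j)
  set a : Fin 4 → E3 → ℝ := fun j z => -(W.basis.coord j z / (W.basis.coord j).linear u) with ha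
  have hLip : ∀ j, ∃ C : NNReal, LipschitzWith C (a j) := by
    intro j
    set M : E3 →L[ℝ] ℝ :=
      LinearMap.toContinuousLinearMap ((-((W.basis.coord j).linear u)⁻¹) • (W.basis.coord j).linear)
    have hM : a j = fun z => M z + a j 0 := by
      funext z
      have h1 : W.basis.coord j z = (W.basis.coord j).linear z + W.basis.coord j 0 := by
        simpa using (W.basis.coord j).map_vadd 0 z
      have h2 : M z = -((W.basis.coord j).linear u)⁻¹ * (W.basis.coord j).linear z := rfl
      simp only [ha]
      rw [h1, h2]
      ring
    rw [hM]
    exact ⟨_, M.lipschitz.add (LipschitzWith.const (a j 0))⟩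
  choose C hC using hLip
  obtain ⟨φ, C', hφ, hφa⟩ := exists_lipschitz_max hIne hC
  refine ⟨u, φ, C', ?_, hφ, ?_⟩
  · rw [hu, norm_smul, hr, norm_inv, norm_norm, inv_mul_cancel₀ (norm_ne_zero_iff.2 hne)]
  · have hev : ∀ᶠ y in 𝓝 x, ∀ j ∈ (Iᶜ : Finset (Fin 4)), 0 < W.basis.coord j y := by
      rw [Filter.eventually_all_finset]
      intro j hj
      exact (W.continuous_coord j).continuousAt.eventually_const_lt (hpos j (by simpa using hj))
    filter_upwards [hev] with y hy
    rw [hφa, mem_K_iff]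
    have key : ∀ j ∈ I, (a j (y - (inner ℝ u y : ℝ) • u) ≤ inner ℝ u y ↔
        0 ≤ W.basis.coord j y) := by
      intro j hj
      have h1 := congrFun (W.bar_add_smul y u (-(inner ℝ u y))) j
      rw [neg_smul, ← sub_eq_add_neg] at h1
      simp only [bar, barVec, Pi.add_apply, Pi.smul_apply, smul_eq_mul] at h1
      simp only [ha]
      rw [h1, neg_le_iff_add_nonneg, add_div, mul_div_cancel_right₀ _ (hL j hj).ne']
      rw [add_comm (inner ℝ u y), add_assoc, neg_add_cancel, add_zero, le_div_iff₀ (hL j hj),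
        zero_mul]
    constructor
    · intro h j hj
      exact (key j hj).2 (h j)
    · intro h j
      by_cases hj : j ∈ I
      · exact (key j hj).1 (h j hj)
      · exact (hy j (by simpa using hj)).le

/-! ### The finite element in the sense of Ciarlet -/

theorem isCiarletFiniteElement {W : Partition} (ν : W.EdgeNormals) :
    IsCiarletFiniteElement W.K W.space (dof ν) where
  isCompact := (finite_range W.Q).isCompact_convexHull ℝ
  interior_nonempty := ⟨W.cK, W.cK_mem⟩
  lipschitz_boundary := W.hasLipschitzBoundary
  finiteDimensional := by
    refine FiniteDimensional.of_injective (LinearMap.pi (dof ν)) fun f g h => ?_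
    exact dof_injective ν fun μ => congrFun h μ
  linearIndependent := by
    rw [Fintype.linearIndependent_iff]
    intro a ha μ
    obtain ⟨-, f, -, hf, hx⟩ := exists_isAlgorithmOutput ν (fun _ => 1) (Pi.single μ 1)
    have h := LinearMap.congr_fun ha ⟨f, hf⟩
    simpa [LinearMap.sum_apply, hx, Pi.single_apply] using h
  unisolvent := by
    intro a
    obtain ⟨-, f, -, hf, hx⟩ := exists_isAlgorithmOutput ν (fun _ => 1) a
    exact ⟨⟨f, hf⟩, hx, fun g hg => dof_injective ν fun μ => (hg μ).trans (hx μ).symm⟩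

end Partition
end WorseyFarin
end

theorem mainTheorem1 (W : WorseyFarin.Partition) (ν : W.EdgeNormals)
    (σ : WorseyFarin.Partition.LocalEnum) :
    (∀ x : Fin 28 → ℝ,
      (∃! cf : WorseyFarin.Partition.Ordinates × (W.K → ℝ),
        WorseyFarin.Partition.IsAlgorithmOutput ν σ x cf.1 cf.2) ∧
      ∀ (c : WorseyFarin.Partition.Ordinates) (f : W.K → ℝ),
        WorseyFarin.Partition.IsAlgorithmOutput ν σ x c f →
          ∃ hf : f ∈ W.space, ∀ μ : Fin 28, WorseyFarin.Partition.dof ν μ ⟨f, hf⟩ = x μ) ∧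
    (∀ (x : Fin 28 → ℝ) (f g : W.space),
      (∀ μ : Fin 28, WorseyFarin.Partition.dof ν μ f = x μ) →
      (∀ μ : Fin 28, WorseyFarin.Partition.dof ν μ g = x μ) → f = g) ∧
    WorseyFarin.IsCiarletFiniteElement W.K W.space (WorseyFarin.Partition.dof ν) := by
  refine ⟨fun x => ?_, fun x f g hf hg => ?_, WorseyFarin.Partition.isCiarletFiniteElement ν⟩
  · obtain ⟨c, f, hout, hf, hx⟩ := WorseyFarin.Partition.exists_isAlgorithmOutput ν σ x
    refine ⟨⟨(c, f), hout, fun cf h => ?_⟩, fun c' f' h => ?_⟩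
    · obtain ⟨h1, h2⟩ := h.unique hout
      exact Prod.ext h1 h2
    · obtain ⟨-, rfl⟩ := h.unique hout
      exact ⟨hf, hx⟩
  · exact WorseyFarin.Partition.dof_injective ν fun μ => (hf μ).trans (hg μ).symm
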